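/- Let $d\ge 2$. Let $\lambda$ be a tempered distribution on $\mathbb R^d$ whose Fourier transform is a locally integrable function satisfying $|\hat\lambda(\xi)|\le C|\xi|^{-\alpha}$ for almost every $\xi$, with some constants $C,\alpha\in\mathbb R$. Let $\mu$ be a compactly supported Borel measure on $\mathbb R^d$ for which there are constants $s>0$, $C'$ and $r_0>0$ with $\mu(B(x,r))\le C'r^s$ for all $x\in\mathbb R^d$ and all $0<r<r_0$. Fix a smooth, non-negative, compactly supported function $\phi$ with $\int\phi=1$, put $\phi_\epsilon(x)=\epsilon^{-d}\phi(x/\epsilon)$, and for $1\le p,q\le\infty$ say that $Af:=\lambda*(f\mu)$ is bounded from $L^p(\mu)$ to $L^q(\mu)$ if for every $f\in L^p(\mu)$ the functions $\lambda*\phi_\epsilon*(f\mu)$ converge in $L^q(\mu)$ as $\epsilon\to0^+$ to a limit $Af\in L^q(\mu)$, and $\|Af\|_{L^q(\mu)}\le K\|f\|_{L^p(\mu)}$ with $K$ independent of $f$. If $s>d-\alpha$, then for $1\le p\le 2$ the operator $A$ is bounded from $L^p(\mu)$ to $L^2(\mu)$ whenever $\frac1p\in\left[\frac12,\frac{3s+2\alpha-2d}{2s}\right)$,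 and from $L^p(\mu)$ to $L^{p'}(\mu)$ whenever $\frac1p\in\left[\frac12,\frac{2s+\alpha-d}{2s}\right)$, where $\frac1p+\frac1{p'}=1$. The thresholds for $p$ and $s$ are sharp up to endpoints, and this is shown by $\lambda=|x|^{-(d-\alpha)}$. Namely, for every $0<\alpha<d$ the function $|x|^{-(d-\alpha)}$ defines a tempered distribution $\lambda$ satisfying the above hypothesis with this $\alpha$, and for every $0<s\le d$ there is a compactly supported Borel measure $\mu$ satisfying the above ball condition with this $s$ such that, for every choice of $\phi$: (i) for $1\le p<\infty$ with $\frac1p>\frac{3s+2\alpha-2d}{2s}$, $A$ is not bounded from $L^p(\mu)$ to $L^2(\mu)$; (ii) for $1\le p<\infty$ with $\frac1p>\frac{2s+\alpha-d}{2s}$, $A$ is not bounded from $L^p(\mu)$ to $L^{p'}(\mu)$; (iii) if $s<d-\alpha$, then $A$ is not bounded from $L^p(\mu)$ to $L^q(\mu)$ for any $1\le p\le q\le\infty$; in particular it is not bounded from $L^p(\mu)$ to $L^2(\mu)$ or to $L^{p'}(\mu)$ for any $1\le p\le2$. -/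

import Mathlib

open MeasureTheory Filter Topology
open scoped ENNReal NNReal SchwartzMap FourierTransform ContDiff

noncomputable section

namespace FractalConv

/-- `ℝ^d` with its Euclidean norm. -/
abbrev E (d : ℕ) : Type := EuclideanSpace ℝ (Fin d)

/-- A smooth non-negative compactly supported function on `ℝ^d` with integral `1`. -/
structure Mollifier (d : ℕ) where
  toFun : E d → ℝ
  smooth : ContDiff ℝ ∞ toFun
  compactSupport : HasCompactSupport toFun
  nonneg : ∀ x, 0 ≤ toFun x
  integral_eq_one : ∫ x, toFun x = 1

namespace Mollifier

variable {d : ℕ} (φ : Mollifier d)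

/-- The approximation of the identity `φ_ε(x) = ε^{-d} φ(x / ε)`. -/
def scaled (ε : ℝ) (x : E d) : ℝ := (ε ^ d)⁻¹ * φ.toFun (ε⁻¹ • x)

/-- The function `y ↦ φ_ε(z - y)`, complex valued. -/
def shifted (ε : ℝ) (z y : E d) : ℂ := ((φ.scaled ε (z - y) : ℝ) : ℂ)

theorem contDiff_shifted (ε : ℝ) (z : E d) : ContDiff ℝ ∞ (φ.shifted ε z) := by
  have h : ContDiff ℝ ∞ (fun y : E d => φ.toFun (ε⁻¹ • (z - y))) :=
    φ.smooth.comp ((contDiff_const.sub contDiff_id).const_smul ε⁻¹)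
  exact Complex.ofRealCLM.contDiff.comp (contDiff_const.mul h)

theorem hasCompactSupport_shifted {ε : ℝ} (hε : 0 < ε) (z : E d) :
    HasCompactSupport (φ.shifted ε z) := by
  have h : HasCompactSupport (fun y : E d => φ.toFun (ε⁻¹ • (z - y))) :=
    φ.compactSupport.comp_homeomorph
      ((Homeomorph.subLeft z).trans (Homeomorph.smulOfNeZero ε⁻¹ (inv_ne_zero hε.ne')))
  refine h.mono' (subset_closure.trans' ?_)
  intro y hy
  simp only [Function.mem_support, shifted, scaled] at hy ⊢
  intro h0
  simp [h0] at hy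

/-- The function `y ↦ φ_ε(z - y)` as a Schwartz function, for `ε > 0`. -/
def shiftedSchwartz {ε : ℝ} (hε : 0 < ε) (z : E d) : 𝓢(E d, ℂ) :=
  (φ.hasCompactSupport_shifted hε z).toSchwartzMap (φ.contDiff_shifted ε z)

end Mollifier

variable {d : ℕ}

open Classical in
/-- The smooth function `Λ * φ_ε`, that is `z ↦ Λ(φ_ε(z - ·))`, for a tempered distribution `Λ`
and `ε > 0` (only positive `ε` are ever used). -/
def mollify (Λ : 𝓢'(E d, ℂ)) (φ : Mollifier d) (ε : ℝ) (z : E d) : ℂ :=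
  if hε : 0 < ε then Λ (φ.shiftedSchwartz hε z) else 0

/-- The function `Λ * φ_ε * (f μ)`, that is `x ↦ ∫ (Λ * φ_ε)(x - y) f(y) dμ(y)`. -/
def regConv (Λ : 𝓢'(E d, ℂ)) (φ : Mollifier d) (μ : Measure (E d)) (ε : ℝ) (f : E d → ℂ)
    (x : E d) : ℂ :=
  ∫ y, mollify Λ φ ε (x - y) * f y ∂μ

/-- `h` is `Λ * (f μ)` as an element of `L^q(μ)`: the limit in `L^q(μ)` of `Λ * φ_ε * (f μ)` as
`ε → 0+`. -/
structure IsConv (Λ : 𝓢'(E d, ℂ)) (φ : Mollifier d) (μ : Measure (E d)) (q : ℝ≥0∞)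
    (f h : E d → ℂ) : Prop where
  memLp : MemLp h q μ
  tendsto : Tendsto (fun ε : ℝ => eLpNorm (fun x => regConv Λ φ μ ε f x - h x) q μ)
    (𝓝[>] 0) (𝓝 0)

/-- The operator `f ↦ Λ * (f μ)` is (defined and) bounded from `L^p(μ)` to `L^q(μ)`. -/
def ConvBounded (Λ : 𝓢'(E d, ℂ)) (φ : Mollifier d) (μ : Measure (E d)) (p q : ℝ≥0∞) : Prop :=
  ∃ K : ℝ≥0, ∀ f : E d → ℂ, MemLp f p μ →
    ∃ h : E d → ℂ, IsConv Λ φ μ q f h ∧ eLpNorm h q μ ≤ K * eLpNorm f p μ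

/-- The Fourier transform of `Λ` is a locally integrable function, bounded by `C |ξ|^{-α}`
for almost every `ξ`. -/
def FourierDecay (Λ : 𝓢'(E d, ℂ)) (α : ℝ) : Prop :=
  ∃ m : E d → ℂ, LocallyIntegrable m ∧
    (∀ ψ : 𝓢(E d, ℂ), 𝓕 Λ ψ = ∫ ξ, m ξ * ψ ξ) ∧
    ∃ C : ℝ, ∀ᵐ ξ, ‖m ξ‖ ≤ C * ‖ξ‖ ^ (-α)

/-- `μ` is carried by a compact set. -/
def CompactlySupported (μ : Measure (E d)) : Prop :=
  ∃ K : Set (E d), IsCompact K ∧ μ Kᶜ = 0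

/-- The ball condition `μ(B(x,r)) ≤ C r^s`, uniformly in all `x` and all sufficiently small `r`. -/
def BallCondition (μ : Measure (E d)) (s : ℝ) : Prop :=
  ∃ C r₀ : ℝ, 0 < r₀ ∧ ∀ (x : E d) (r : ℝ), 0 < r → r < r₀ →
    μ (Metric.ball x r) ≤ ENNReal.ofReal (C * r ^ s)

/-- `Λ` is the tempered distribution given by the function `|x|^{-(d-α)}`. -/
def IsRieszKernel (Λ : 𝓢'(E d, ℂ)) (α : ℝ) : Prop :=
  ∀ ψ : 𝓢(E d, ℂ), Λ ψ = ∫ x : E d, ((‖x‖ ^ (-((d : ℝ) - α)) : ℝ) : ℂ) * ψ x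

end FractalConv

end

noncomputable section

namespace FractalConv

variable {d : ℕ}

/-! Boundedness rests on a weighted L² restriction estimate. Write F(f)(ξ) for the Fourier transform
of f μ. For 1 ≤ p ≤ 2 and β > d/2 - s(1 - 1/p), the integral of |F(f)|² |ξ|^(-2β) over |ξ| ≥ 1 is at
most K ‖f‖_p² (`exists_lintegral_sq_fourierOf_le`). To see this, dominate |ξ|^(-2β) by a
superposition of the Gaussians exp(-πt|ξ|²), 0 < t < 1, with density t^(β-1). By Fubini, each
Gaussian average of |F(f)|² is t^(-d/2) times the quadratic form of f with kernel exp(-π|x-y|²/t).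
The ball condition bounds the μ-integral of this kernel by a multiple of t^(s/2), and a Young-type
inequality turns that into t^(s(1-1/p)) ‖f‖_p². The remaining t-integral converges exactly under the
condition on β.

The pairing of Af with g is the integral of m F(f) times the conjugate of F(g), where m is the
Fourier transform of λ. Splitting α = β₁ + β₂ and applying Cauchy–Schwarz reduces it to two
restriction estimates, one for f in L^p and one for g in the dual of L^q. This works when α > d -
s(1 - 1/p) - s/q, and q = 2 and q = p' give the two thresholds. Low frequencies are harmless because
m is locally integrable. For p = 1 and q = ∞ a direct sup bound replaces duality. The limit ε → 0
exists because the symbol of φ_ε is bounded by 1 and tends to 1, so dominated convergence applies to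
the same weighted L² integrals (`convBounded_of_multiplier_estimate`).

For sharpness, μ is |x|^(s-d) dx on the unit ball, so that μ(B(0,r)) = κ r^s. On B(0,r) the
potential of the indicator of B(0,r) is at least a constant times r^(α-d) r^s. Boundedness would
force r^(s + s/q - (d-α)) ≤ const · r^(s/p) as r → 0, which fails beyond the stated thresholds
(`not_convBounded_rieszKernel`). The decay hypothesis for the Riesz kernel follows by writing both
|x|^(-(d-α)) and |ξ|^(-α) as superpositions of Gaussians. -/

/-! ### Ball condition, Gaussian averages and a Young-type inequality -/

/-- Small balls make μ locally finite, hence finite on its compact carrier. Radii r ≥ r₀ are then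
absorbed by the total mass divided by r₀^s, which frees the later Gaussian estimates from the
restriction r < r₀. -/
theorem exists_ball_bound {μ : Measure (E d)} {s : ℝ} (hK : CompactlySupported μ)
    (hB : BallCondition μ s) (hs : 0 < s) :
    IsFiniteMeasure μ ∧ ∃ C : ℝ, 0 ≤ C ∧ ∀ (x : E d) (r : ℝ), 0 < r →
      μ (Metric.ball x r) ≤ ENNReal.ofReal (C * r ^ s) := by
  obtain ⟨K, hK, hK0⟩ := hK
  obtain ⟨C, r₀, hr₀, hC⟩ := hB
  have hlf : IsLocallyFiniteMeasure μ := ⟨fun x ↦ ⟨Metric.ball x (r₀ / 2),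
    Metric.ball_mem_nhds x (by positivity),
    (hC x (r₀ / 2) (by positivity) (by linarith)).trans_lt ENNReal.ofReal_lt_top⟩⟩
  have hfin : IsFiniteMeasure μ := by
    refine ⟨?_⟩
    calc μ Set.univ = μ (K ∪ Kᶜ) := by rw [Set.union_compl_self]
      _ ≤ μ K + μ Kᶜ := measure_union_le _ _
      _ < ⊤ := by rw [hK0, add_zero]; exact hK.measure_lt_top
  refine ⟨hfin, max 0 (max C (μ.real Set.univ / r₀ ^ s)), le_max_left _ _, fun x r hr ↦ ?_⟩
  have hrs : 0 < r ^ s := Real.rpow_pos_of_pos hr s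
  rcases lt_or_ge r r₀ with h | h
  · refine (hC x r hr h).trans (ENNReal.ofReal_le_ofReal ?_)
    gcongr
    exact (le_max_left _ _).trans (le_max_right _ _)
  · calc μ (Metric.ball x r) ≤ μ Set.univ := measure_mono (Set.subset_univ _)
      _ = ENNReal.ofReal (μ.real Set.univ) := by rw [measureReal_def, ENNReal.ofReal_toReal (by simp)]
      _ ≤ _ := by
        refine ENNReal.ofReal_le_ofReal ?_
        have hr0s : 0 < r₀ ^ s := Real.rpow_pos_of_pos hr₀ s
        calc μ.real Set.univ = μ.real Set.univ / r₀ ^ s * r₀ ^ s := by field_simp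
          _ ≤ max 0 (max C (μ.real Set.univ / r₀ ^ s)) * r ^ s := by
            gcongr
            exact (le_max_right _ _).trans (le_max_right _ _)

theorem summable_exp_neg_pi_sq_mul_rpow (s : ℝ) :
    Summable fun k : ℕ ↦ Real.exp (-Real.pi * (k : ℝ) ^ 2) * ((k : ℝ) + 1) ^ s := by
  have h := (summable_nat_add_iff 1).mpr (Real.summable_pow_mul_exp_neg_nat_mul ⌈s⌉₊ one_pos)
  refine Summable.of_nonneg_of_le (fun k ↦ by positivity) (fun k ↦ ?_) (h.mul_left (Real.exp 1))
  have h1 : ((k : ℝ) + 1) ^ s ≤ ((k : ℝ) + 1) ^ ⌈s⌉₊ := by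
    rw [← Real.rpow_natCast]
    exact Real.rpow_le_rpow_of_exponent_le (by linarith [(Nat.cast_nonneg k : (0 : ℝ) ≤ k)])
      (Nat.le_ceil s)
  have h2 : Real.exp (-Real.pi * (k : ℝ) ^ 2) ≤ Real.exp 1 * Real.exp (-1 * ((k + 1 : ℕ) : ℝ)) := by
    rw [← Real.exp_add]
    refine Real.exp_le_exp.mpr ?_
    push_cast
    have : (k : ℝ) ≤ (k : ℝ) ^ 2 := by
      exact_mod_cast Nat.le_self_pow two_ne_zero k
    nlinarith [Real.pi_gt_three]
  calc _ ≤ (Real.exp 1 * Real.exp (-1 * ((k + 1 : ℕ) : ℝ))) * ((k : ℝ) + 1) ^ ⌈s⌉₊ := by gcongr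
    _ = _ := by push_cast; ring

/-- Gaussian averages of a measure satisfying a ball condition. -/
theorem exists_lintegral_gaussian_le {μ : Measure (E d)} {s C : ℝ} (hC : 0 ≤ C)
    (hμ : ∀ (x : E d) (r : ℝ), 0 < r → μ (Metric.ball x r) ≤ ENNReal.ofReal (C * r ^ s)) :
    ∃ B : ℝ, 0 ≤ B ∧ ∀ (x : E d) (t : ℝ), 0 < t →
      ∫⁻ y, ENNReal.ofReal (Real.exp (-Real.pi * ‖x - y‖ ^ 2 / t)) ∂μ ≤
        ENNReal.ofReal (B * t ^ (s / 2)) := by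
  -- The constant sums over the shells k√t ≤ |x-y| < (k+1)√t: the Gaussian is at most exp(-πk²)
  -- there, and the shell lies in a ball of mass at most C ((k+1)√t)^s.
  refine ⟨∑' k : ℕ, C * (Real.exp (-Real.pi * (k : ℝ) ^ 2) * ((k : ℝ) + 1) ^ s),
    tsum_nonneg fun k ↦ by positivity, fun x t ht ↦ ?_⟩
  have hst : 0 < √t := Real.sqrt_pos.mpr ht
  have hpt : ∀ y, ENNReal.ofReal (Real.exp (-Real.pi * ‖x - y‖ ^ 2 / t)) ≤
      ∑' k : ℕ, (Metric.ball x (((k : ℝ) + 1) * √t)).indicator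
        (fun _ ↦ ENNReal.ofReal (Real.exp (-Real.pi * (k : ℝ) ^ 2))) y := by
    intro y
    set k := ⌊‖x - y‖ / √t⌋₊
    refine le_trans ?_ (ENNReal.le_tsum k)
    have h1 : ‖x - y‖ / √t < k + 1 := Nat.lt_floor_add_one _
    have h2 : (k : ℝ) ≤ ‖x - y‖ / √t := Nat.floor_le (by positivity)
    rw [Set.indicator_of_mem]
    · refine ENNReal.ofReal_le_ofReal (Real.exp_le_exp.mpr ?_)
      have : (k : ℝ) ^ 2 ≤ ‖x - y‖ ^ 2 / t := by
        calc (k : ℝ) ^ 2 ≤ (‖x - y‖ / √t) ^ 2 := by gcongr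
          _ = _ := by rw [div_pow, Real.sq_sqrt ht.le]
      have h3 := mul_le_mul_of_nonneg_left this Real.pi_pos.le
      calc _ = -(Real.pi * (‖x - y‖ ^ 2 / t)) := by ring
        _ ≤ _ := by linarith
    · rw [Metric.mem_ball, dist_comm, dist_eq_norm]
      rwa [div_lt_iff₀ hst] at h1
  calc _ ≤ ∫⁻ y, ∑' k : ℕ, (Metric.ball x (((k : ℝ) + 1) * √t)).indicator
        (fun _ ↦ ENNReal.ofReal (Real.exp (-Real.pi * (k : ℝ) ^ 2))) y ∂μ := lintegral_mono hpt
    _ = ∑' k : ℕ, ENNReal.ofReal (Real.exp (-Real.pi * (k : ℝ) ^ 2)) *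
          μ (Metric.ball x (((k : ℝ) + 1) * √t)) := by
        rw [lintegral_tsum]
        · simp_rw [lintegral_indicator_const Metric.isOpen_ball.measurableSet]
        · exact fun k ↦ (measurable_const.indicator Metric.isOpen_ball.measurableSet).aemeasurable
    _ ≤ ∑' k : ℕ, ENNReal.ofReal (C * (Real.exp (-Real.pi * (k : ℝ) ^ 2) * ((k : ℝ) + 1) ^ s) *
          t ^ (s / 2)) := by
        refine ENNReal.tsum_le_tsum fun k ↦ ?_
        calc _ ≤ ENNReal.ofReal (Real.exp (-Real.pi * (k : ℝ) ^ 2)) *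
              ENNReal.ofReal (C * (((k : ℝ) + 1) * √t) ^ s) := by
                gcongr
                exact hμ _ _ (by positivity)
          _ = _ := by
            rw [← ENNReal.ofReal_mul (by positivity), Real.mul_rpow (by positivity) (by positivity),
              Real.sqrt_eq_rpow, ← Real.rpow_mul ht.le]
            ring_nf
    _ = _ := by
        have hs := ((summable_exp_neg_pi_sq_mul_rpow s).mul_left C)
        rw [← ENNReal.ofReal_tsum_of_nonneg (fun k ↦ by positivity) (hs.mul_right _),
          tsum_mul_right]

/-- A form of Young's inequality for symmetric kernels, obtained from Hölder's inequality. -/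
theorem lintegral_lintegral_mul_mul_le {α : Type*} [MeasurableSpace α] {μ : Measure α} [SFinite μ]
    {F : α → ℝ≥0∞} (hF : AEMeasurable F μ) {k : α → α → ℝ≥0∞} (hk : Measurable (Function.uncurry k))
    (hsymm : ∀ x y, k x y = k y x) (hk1 : ∀ x y, k x y ≤ 1) {B : ℝ≥0∞}
    (hkB : ∀ x, ∫⁻ y, k x y ∂μ ≤ B) {p : ℝ} (hp1 : 1 ≤ p) (hp2 : p ≤ 2) :
    ∫⁻ x, ∫⁻ y, F x * F y * k x y ∂μ ∂μ ≤ B ^ (2 * (1 - 1 / p)) * (∫⁻ x, F x ^ p ∂μ) ^ (2 / p) := by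
  have hp0 : 0 < p := by linarith
  -- Three-function Hölder with exponents a, a, b summing to 1, applied to F(x)^p k, F(y)^p k and
  -- F(x)^p F(y)^p. Each F is recovered since p(a + b) = 1. The kernel is recovered only up to k ≤
  -- k^(2a), which uses k ≤ 1 and 2a ≤ 1, that is p ≤ 2.
  set a : ℝ := 1 - 1 / p with ha
  set b : ℝ := 2 / p - 1 with hb
  have ha0 : 0 ≤ a := by
    rw [ha, sub_nonneg, div_le_one hp0]; exact hp1
  have hb0 : 0 ≤ b := by
    rw [hb, sub_nonneg, le_div_iff₀ hp0]; linarith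
  have hab : a + a + b = 1 := by rw [ha, hb]; ring
  have hpab : p * a + p * b = 1 := by rw [ha, hb]; field_simp; ring
  have hsplit : ∀ u : ℝ≥0∞, u = (u ^ p) ^ a * (u ^ p) ^ b := fun u ↦ by
    rw [← ENNReal.rpow_mul, ← ENNReal.rpow_mul, ← ENNReal.rpow_add_of_nonneg _ _ (by positivity)
      (by positivity), hpab, ENNReal.rpow_one]
  have hF1 : AEMeasurable (fun z : α × α ↦ F z.1) (μ.prod μ) := hF.comp_fst
  have hF2 : AEMeasurable (fun z : α × α ↦ F z.2) (μ.prod μ) := hF.comp_snd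
  have hkm : AEMeasurable (fun z : α × α ↦ k z.1 z.2) (μ.prod μ) := hk.aemeasurable
  rw [← lintegral_prod (fun z : α × α ↦ F z.1 * F z.2 * k z.1 z.2) ((hF1.mul hF2).mul hkm)]
  set g : Fin 3 → α × α → ℝ≥0∞ := ![fun z ↦ F z.1 ^ p * k z.1 z.2, fun z ↦ F z.2 ^ p * k z.1 z.2,
    fun z ↦ F z.1 ^ p * F z.2 ^ p] with hg
  have hgm : ∀ i ∈ Finset.univ, AEMeasurable (g i) (μ.prod μ) := by
    intro i _
    fin_cases i
    · exact (hF1.pow_const p).mul hkm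
    · exact (hF2.pow_const p).mul hkm
    · exact (hF1.pow_const p).mul (hF2.pow_const p)
  have hH := ENNReal.lintegral_prod_norm_pow_le Finset.univ hgm (p := ![a, a, b])
    (by simpa [Fin.sum_univ_three] using hab) (by intro i _; fin_cases i <;> simp [ha0, hb0])
  simp only [Fin.prod_univ_three, hg, Matrix.cons_val_zero, Matrix.cons_val_one, Matrix.cons_val]
    at hH
  have hle : ∀ z : α × α, F z.1 * F z.2 * k z.1 z.2 ≤
      (F z.1 ^ p * k z.1 z.2) ^ a * (F z.2 ^ p * k z.1 z.2) ^ a * (F z.1 ^ p * F z.2 ^ p) ^ b := by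
    intro z
    have hkz : k z.1 z.2 ≤ k z.1 z.2 ^ a * k z.1 z.2 ^ a := by
      rw [← ENNReal.rpow_add_of_nonneg _ _ ha0 ha0]
      conv_lhs => rw [← ENNReal.rpow_one (k z.1 z.2)]
      exact ENNReal.rpow_le_rpow_of_exponent_ge (hk1 _ _) (by linarith)
    simp only [ENNReal.mul_rpow_of_nonneg _ _ ha0, ENNReal.mul_rpow_of_nonneg _ _ hb0]
    calc F z.1 * F z.2 * k z.1 z.2 ≤ ((F z.1 ^ p) ^ a * (F z.1 ^ p) ^ b) *
          ((F z.2 ^ p) ^ a * (F z.2 ^ p) ^ b) * (k z.1 z.2 ^ a * k z.1 z.2 ^ a) := by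
          rw [← hsplit, ← hsplit]; gcongr
      _ = _ := by ring
  have h1 : ∫⁻ z, F z.1 ^ p * k z.1 z.2 ∂(μ.prod μ) ≤ B * ∫⁻ x, F x ^ p ∂μ := by
    rw [lintegral_prod (fun z : α × α ↦ F z.1 ^ p * k z.1 z.2) ((hF1.pow_const p).mul hkm),
      ← lintegral_const_mul'' _ (hF.pow_const p)]
    refine lintegral_mono fun x ↦ ?_
    have hkx : Measurable (k x) := hk.comp measurable_prodMk_left
    dsimp only
    rw [lintegral_const_mul _ hkx, mul_comm]
    exact mul_le_mul_left (hkB x) _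
  have h2 : ∫⁻ z, F z.2 ^ p * k z.1 z.2 ∂(μ.prod μ) ≤ B * ∫⁻ x, F x ^ p ∂μ := by
    rw [lintegral_prod_symm (fun z : α × α ↦ F z.2 ^ p * k z.1 z.2)
      ((hF2.pow_const p).mul hkm), ← lintegral_const_mul'' _ (hF.pow_const p)]
    refine lintegral_mono fun x ↦ ?_
    simp only [hsymm _ x]
    have hkx : Measurable (k x) := hk.comp measurable_prodMk_left
    rw [lintegral_const_mul _ hkx, mul_comm]
    exact mul_le_mul_left (hkB x) _
  have h3 : ∫⁻ z, F z.1 ^ p * F z.2 ^ p ∂(μ.prod μ) = (∫⁻ x, F x ^ p ∂μ) * ∫⁻ x, F x ^ p ∂μ :=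
    lintegral_prod_mul (hF.pow_const p) (hF.pow_const p)
  calc _ ≤ _ := lintegral_mono hle
    _ ≤ _ := hH
    _ ≤ (B * ∫⁻ x, F x ^ p ∂μ) ^ a * (B * ∫⁻ x, F x ^ p ∂μ) ^ a *
        ((∫⁻ x, F x ^ p ∂μ) * ∫⁻ x, F x ^ p ∂μ) ^ b := by
        rw [h3]; gcongr
    _ = _ := by
        simp only [ENNReal.mul_rpow_of_nonneg _ _ ha0, ENNReal.mul_rpow_of_nonneg _ _ hb0]
        have e1 : B ^ (2 * a) = B ^ a * B ^ a := by
          rw [two_mul, ENNReal.rpow_add_of_nonneg _ _ ha0 ha0]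
        have e2 : ∀ I : ℝ≥0∞, I ^ (2 / p) = I ^ a * I ^ a * (I ^ b * I ^ b) := fun I ↦ by
          rw [← ENNReal.rpow_add_of_nonneg _ _ ha0 ha0, ← ENNReal.rpow_add_of_nonneg _ _ hb0 hb0,
            ← ENNReal.rpow_add_of_nonneg _ _ (by positivity) (by positivity)]
          congr 1
          rw [ha, hb]; ring
        rw [e1, e2]
        ring

/-! ### The Fourier transform of f μ and the weighted restriction estimate -/

/-- The Fourier transform `ξ ↦ ∫ e^{-2πi x·ξ} f(x) dμ(x)` of the measure `f μ`. -/
def fourierOf (μ : Measure (E d)) (f : E d → ℂ) (ξ : E d) : ℂ :=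
  VectorFourier.fourierIntegral Real.fourierChar μ (innerₗ (E d)) f ξ

theorem continuous_innerₗ_uncurry :
    Continuous fun z : E d × E d ↦ (innerₗ (E d)) z.1 z.2 := by
  simpa only [innerₗ_apply_apply] using! continuous_inner

theorem continuous_fourierOf {μ : Measure (E d)} {f : E d → ℂ} (hf : Integrable f μ) :
    Continuous (fourierOf μ f) :=
  VectorFourier.fourierIntegral_continuous Real.continuous_fourierChar
    continuous_innerₗ_uncurry hf

theorem norm_fourierOf_le (μ : Measure (E d)) (f : E d → ℂ) (ξ : E d) :
    ‖fourierOf μ f ξ‖ ≤ ∫ x, ‖f x‖ ∂μ :=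
  VectorFourier.norm_fourierIntegral_le_integral_norm _ _ _ _ _

theorem integrable_exp_neg_norm_sq {b : ℝ} (hb : 0 < b) :
    Integrable fun ξ : E d ↦ Real.exp (-b * ‖ξ‖ ^ 2) := by
  have := (GaussianFourier.integrable_cexp_neg_mul_sq_norm_add (V := E d) (b := (b : ℂ))
    (by simpa using hb) 0 0).re
  refine this.congr (ae_of_all _ fun ξ ↦ ?_)
  simp only [zero_mul, add_zero]
  norm_cast

/-- Modulation by x moves the centre of the transformed Gaussian to x. This produces the kernel
exp(-π|x-y|²/t) of the quadratic form below. -/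
theorem fourier_modulated_gaussian {t : ℝ} (ht : 0 < t) (x y : E d) :
    fourierOf volume (fun ξ : E d ↦ Real.fourierChar (inner ℝ x ξ) •
      (Real.exp (-(Real.pi * t) * ‖ξ‖ ^ 2) : ℂ)) y =
      ((t ^ (-((d : ℝ) / 2)) * Real.exp (-Real.pi * ‖x - y‖ ^ 2 / t) : ℝ) : ℂ) := by
  have h := fourier_gaussian_innerProductSpace' (V := E d) (b := ((Real.pi * t : ℝ) : ℂ))
    (by simp; positivity) x y
  have hfun : (fun ξ : E d ↦ Real.fourierChar (inner ℝ x ξ) •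
      (Real.exp (-(Real.pi * t) * ‖ξ‖ ^ 2) : ℂ)) = fun ξ : E d ↦
      Complex.exp (-((Real.pi * t : ℝ) : ℂ) * ‖ξ‖ ^ 2 + 2 * Real.pi * Complex.I *
        ((inner ℝ x ξ : ℝ) : ℂ)) := by
    ext ξ
    rw [Circle.smul_def, Real.fourierChar_apply, Complex.exp_add, Complex.ofReal_exp, smul_eq_mul,
      mul_comm]
    push_cast
    congr 2
    ring
  rw [hfun]
  refine Eq.trans ?_ (h.trans ?_)
  · rfl
  · have hpi : (Real.pi : ℂ) ≠ 0 := by exact_mod_cast Real.pi_ne_zero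
    have htc : (t : ℂ) ≠ 0 := by exact_mod_cast ht.ne'
    have h1 : ((Real.pi : ℂ) / ((Real.pi * t : ℝ) : ℂ)) = ((t⁻¹ : ℝ) : ℂ) := by
      push_cast; field_simp
    rw [h1, finrank_euclideanSpace_fin, Complex.ofReal_mul (t ^ _), Complex.ofReal_exp,
      Real.rpow_neg ht.le, ← Real.inv_rpow ht.le, Complex.ofReal_cpow (by positivity)]
    congr 2
    · push_cast; rfl
    · push_cast; field_simp

/-- The weight G makes everything absolutely integrable, so both Fourier transforms in |F(f)|² G can
be moved onto G by Fubini: the conjugated one modulates G by x, the other transforms the result at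
y. Taking absolute values inside the double integral gives the bound. -/
theorem lintegral_sq_fourierOf_mul_gaussian_le {μ : Measure (E d)} [IsFiniteMeasure μ]
    {f : E d → ℂ} (hf : Integrable f μ) {t : ℝ} (ht : 0 < t) :
    ∫⁻ ξ, ‖fourierOf μ f ξ‖ₑ ^ 2 * ENNReal.ofReal (Real.exp (-(Real.pi * t) * ‖ξ‖ ^ 2)) ≤
      ENNReal.ofReal (t ^ (-((d : ℝ) / 2))) * ∫⁻ x, ∫⁻ y, ‖f x‖ₑ * ‖f y‖ₑ *
        ENNReal.ofReal (Real.exp (-Real.pi * ‖x - y‖ ^ 2 / t)) ∂μ ∂μ := by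
  set G : E d → ℝ := fun ξ ↦ Real.exp (-(Real.pi * t) * ‖ξ‖ ^ 2) with hG
  have hGint : Integrable G := integrable_exp_neg_norm_sq (by positivity)
  have hcont := continuous_fourierOf hf
  have hFG : Integrable fun ξ ↦ fourierOf μ f ξ * (G ξ : ℂ) :=
    hGint.ofReal.bdd_mul hcont.aestronglyMeasurable (ae_of_all _ fun ξ ↦ norm_fourierOf_le μ f ξ)
  have h1 : ∫ ξ, (starRingEnd ℂ) (fourierOf μ f ξ) * (fourierOf μ f ξ * (G ξ : ℂ)) =
      ∫ x, (starRingEnd ℂ) (f x) * (∫ ξ, fourierOf μ f ξ *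
        (Real.fourierChar (inner ℝ x ξ) • (G ξ : ℂ))) ∂μ := by
    have := VectorFourier.integral_sesq_fourierIntegral_eq_neg_flip (μ := μ) (ν := volume)
      (L := innerₗ (E d)) (f := f) (g := fun ξ ↦ fourierOf μ f ξ * (G ξ : ℂ))
      (innerSL ℂ (E := ℂ)) Real.continuous_fourierChar continuous_innerₗ_uncurry hf hFG
    simp only [innerSL_apply_apply, RCLike.inner_apply] at this
    calc _ = ∫ ξ, (fourierOf μ f ξ * (G ξ : ℂ)) * (starRingEnd ℂ) (fourierOf μ f ξ) := by
          simp_rw [mul_comm]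
      _ = _ := this
      _ = _ := by
        refine integral_congr_ae (ae_of_all _ fun x ↦ ?_)
        simp only [VectorFourier.fourierIntegral, LinearMap.neg_apply, flip_innerₗ, neg_neg,
          innerₗ_apply_apply, mul_smul_comm]
        rw [mul_comm]
        simp only [real_inner_comm x]
  have h2 : ∀ x, ∫ ξ, fourierOf μ f ξ * (Real.fourierChar (inner ℝ x ξ) • (G ξ : ℂ)) =
      ∫ y, f y * ((t ^ (-((d : ℝ) / 2)) * Real.exp (-Real.pi * ‖x - y‖ ^ 2 / t) : ℝ) : ℂ) ∂μ := by
    intro x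
    have hg : Integrable fun ξ ↦ Real.fourierChar (inner ℝ x ξ) • (G ξ : ℂ) := by
      have hGc : Integrable fun ξ ↦ (G ξ : ℂ) := hGint.ofReal
      refine hGc.mono ?_ (ae_of_all _ fun ξ ↦ by simp [Circle.norm_smul])
      have : Continuous fun ξ : E d ↦ Real.fourierChar (inner ℝ x ξ) :=
        Real.continuous_fourierChar.comp (by fun_prop)
      exact this.aestronglyMeasurable.smul hGc.aestronglyMeasurable
    have := VectorFourier.integral_fourierIntegral_smul_eq_flip (μ := μ) (ν := volume)
      (L := innerₗ (E d)) (f := f) (g := fun ξ ↦ Real.fourierChar (inner ℝ x ξ) • (G ξ : ℂ))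
      Real.continuous_fourierChar continuous_innerₗ_uncurry hf hg
    simp only [smul_eq_mul, flip_innerₗ] at this
    refine Eq.trans this (integral_congr_ae (ae_of_all _ fun y ↦ ?_))
    beta_reduce
    rw [← fourier_modulated_gaussian ht x y]
    rfl
  have hreal : ∫⁻ ξ, ‖fourierOf μ f ξ‖ₑ ^ 2 * ENNReal.ofReal (G ξ) =
      ‖∫ ξ, (starRingEnd ℂ) (fourierOf μ f ξ) * (fourierOf μ f ξ * (G ξ : ℂ))‖ₑ := by
    have hpt : ∀ ξ, (starRingEnd ℂ) (fourierOf μ f ξ) * (fourierOf μ f ξ * (G ξ : ℂ)) =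
        ((‖fourierOf μ f ξ‖ ^ 2 * G ξ : ℝ) : ℂ) := fun ξ ↦ by
      rw [← mul_assoc, Complex.conj_mul']; push_cast; rfl
    have hnn : ∀ ξ, 0 ≤ ‖fourierOf μ f ξ‖ ^ 2 * G ξ := fun ξ ↦ by positivity
    have hint : Integrable fun ξ ↦ ‖fourierOf μ f ξ‖ ^ 2 * G ξ := by
      refine hGint.bdd_mul (c := (∫ x, ‖f x‖ ∂μ) ^ 2) (hcont.norm.pow 2).aestronglyMeasurable
        (ae_of_all _ fun ξ ↦ ?_)
      rw [norm_pow, norm_norm]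
      gcongr
      exact norm_fourierOf_le μ f ξ
    simp_rw [hpt]
    rw [integral_complex_ofReal, ← ofReal_norm, Complex.norm_real, Real.norm_eq_abs,
      abs_of_nonneg (integral_nonneg hnn), ofReal_integral_eq_lintegral_ofReal hint
        (ae_of_all _ hnn)]
    refine lintegral_congr fun ξ ↦ ?_
    rw [ENNReal.ofReal_mul (by positivity), ENNReal.ofReal_pow (norm_nonneg _),
      ofReal_norm]
  rw [hreal, h1]
  simp only [h2]
  refine (enorm_integral_le_lintegral_enorm _).trans ?_
  rw [← lintegral_const_mul' _ _ ENNReal.ofReal_ne_top]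
  refine lintegral_mono fun x ↦ ?_
  rw [enorm_mul, RCLike.enorm_conj, ← lintegral_const_mul' _ _ ENNReal.ofReal_ne_top]
  refine (mul_le_mul_right (enorm_integral_le_lintegral_enorm _) _).trans ?_
  rw [← lintegral_const_mul' _ _ enorm_ne_top]
  refine lintegral_mono fun y ↦ ?_
  rw [enorm_mul, ← ofReal_norm ((_ : ℝ) : ℂ), Complex.norm_real, Real.norm_eq_abs,
    abs_of_nonneg (by positivity), ENNReal.ofReal_mul (by positivity)]
  exact le_of_eq (by ring)

/-- Only a lower bound on the superposition is needed, so it suffices to keep the window 1/2 < t|ξ|²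
< 1. There the exponential is at least exp(-π), t^(β-1) is comparable to |ξ|^(2(1-β)), and the
length is 1/(2|ξ|²). The condition |ξ| ≥ 1 keeps the window inside (0,1), whatever the sign of β. -/
theorem exists_rpow_neg_le_lintegral_gaussian (β : ℝ) :
    ∃ c : ℝ, 0 ≤ c ∧ ∀ ξ : E d, 1 ≤ ‖ξ‖ → ENNReal.ofReal (‖ξ‖ ^ (-(2 * β))) ≤
      ENNReal.ofReal c * ∫⁻ t in Set.Ioo (0 : ℝ) 1,
        ENNReal.ofReal (t ^ (β - 1)) * ENNReal.ofReal (Real.exp (-(Real.pi * t) * ‖ξ‖ ^ 2)) := by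
  set m : ℝ := (1 / 2 : ℝ) ^ |β - 1| with hm
  have hm0 : 0 < m := by positivity
  refine ⟨2 * Real.exp Real.pi / m, by positivity, fun ξ hξ ↦ ?_⟩
  set r : ℝ := ‖ξ‖ ^ 2 with hr
  have hr1 : 1 ≤ r := one_le_pow₀ hξ
  have hr0 : 0 < r := by linarith
  have hlow : ∀ t ∈ Set.Ioo (1 / (2 * r)) (1 / r),
      ENNReal.ofReal (m * r ^ (1 - β) * Real.exp (-Real.pi)) ≤
      ENNReal.ofReal (t ^ (β - 1)) * ENNReal.ofReal (Real.exp (-(Real.pi * t) * r)) := by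
    intro t ht
    have ht0 : 0 < t := lt_trans (by positivity) ht.1
    have h1 : t * r < 1 := by have := ht.2; rwa [lt_div_iff₀ hr0] at this
    have h2 : 1 / 2 < t * r := by
      have := ht.1
      rw [div_lt_iff₀ (by positivity)] at this
      linarith
    rw [← ENNReal.ofReal_mul (by positivity)]
    refine ENNReal.ofReal_le_ofReal ?_
    have e1 : t ^ (β - 1) = (t * r) ^ (β - 1) * r ^ (1 - β) := by
      rw [Real.mul_rpow ht0.le hr0.le, mul_assoc, ← Real.rpow_add hr0]
      simp
    rw [e1]
    have e2 : m ≤ (t * r) ^ (β - 1) :=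
      calc m ≤ (t * r) ^ |β - 1| := Real.rpow_le_rpow (by norm_num) h2.le (abs_nonneg _)
        _ ≤ _ := Real.rpow_le_rpow_of_exponent_ge (by positivity) h1.le (le_abs_self _)
    gcongr
    nlinarith [Real.pi_pos]
  have hsub : Set.Ioo (1 / (2 * r)) (1 / r) ⊆ Set.Ioo (0 : ℝ) 1 := fun t ht ↦
    ⟨lt_trans (by positivity) ht.1, ht.2.trans_le ((div_le_one hr0).mpr hr1)⟩
  have hint : ENNReal.ofReal (m * r ^ (1 - β) * Real.exp (-Real.pi) * (1 / (2 * r))) ≤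
      ∫⁻ t in Set.Ioo (0 : ℝ) 1, ENNReal.ofReal (t ^ (β - 1)) *
        ENNReal.ofReal (Real.exp (-(Real.pi * t) * r)) := by
    calc _ = ∫⁻ t in Set.Ioo (1 / (2 * r)) (1 / r),
          ENNReal.ofReal (m * r ^ (1 - β) * Real.exp (-Real.pi)) := by
          rw [setLIntegral_const, Real.volume_Ioo, ← ENNReal.ofReal_mul (by positivity)]
          congr 2
          field_simp; ring
      _ ≤ _ := setLIntegral_mono' measurableSet_Ioo hlow
      _ ≤ _ := lintegral_mono_set hsub
  refine le_trans ?_ (mul_le_mul_right hint _)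
  rw [← ENNReal.ofReal_mul (by positivity)]
  refine ENNReal.ofReal_le_ofReal (le_of_eq ?_)
  have e3 : ‖ξ‖ ^ (-(2 * β)) = r ^ (-β) := by
    rw [hr, ← Real.rpow_natCast, ← Real.rpow_mul (norm_nonneg _)]
    congr 1; push_cast; ring
  have e4 : r ^ (1 - β) = r * r ^ (-β) := by
    rw [sub_eq_add_neg, Real.rpow_add hr0, Real.rpow_one]
  rw [e3, e4, Real.exp_neg]
  field_simp

/-- A weighted `L²` restriction estimate for the Fourier transform of `f μ`. -/
theorem exists_lintegral_sq_fourierOf_le {μ : Measure (E d)} [IsFiniteMeasure μ] {s C : ℝ}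
    (hC : 0 ≤ C)
    (hμ : ∀ (x : E d) (r : ℝ), 0 < r → μ (Metric.ball x r) ≤ ENNReal.ofReal (C * r ^ s))
    {p β : ℝ} (hp1 : 1 ≤ p) (hp2 : p ≤ 2) (hβ : (d : ℝ) / 2 - s * (1 - 1 / p) < β) :
    ∃ K : ℝ≥0, ∀ f : E d → ℂ, MemLp f (ENNReal.ofReal p) μ →
      ∫⁻ ξ in {ξ | 1 ≤ ‖ξ‖}, ‖fourierOf μ f ξ‖ₑ ^ 2 * ENNReal.ofReal (‖ξ‖ ^ (-(2 * β))) ≤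
        K * eLpNorm f (ENNReal.ofReal p) μ ^ 2 := by
  have hp0 : 0 < p := by linarith
  set a : ℝ := 1 - 1 / p with ha
  have ha0 : 0 ≤ a := by
    rw [ha, sub_nonneg, div_le_one hp0]; exact hp1
  obtain ⟨B, hB0, hB⟩ := exists_lintegral_gaussian_le hC hμ
  obtain ⟨c, hc0, hc⟩ := exists_rpow_neg_le_lintegral_gaussian (d := d) β
  -- Total power of t: β - 1 from the superposition, -d/2 from the Gaussian transform, and s·a from
  -- the kernel mass t^(s/2) raised to the power 2a. The hypothesis on β says precisely that γ > -1.
  set γ : ℝ := β - 1 - (d : ℝ) / 2 + s * a with hγ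
  have hγ1 : -1 < γ := by rw [hγ]; linarith
  have hfin : ∫⁻ t in Set.Ioo (0 : ℝ) 1, ENNReal.ofReal (t ^ γ) ≠ ⊤ := by
    have h := (intervalIntegral.integrableOn_Ioo_rpow_iff (s := γ) zero_lt_one).mpr hγ1
    have h2 := h.hasFiniteIntegral
    refine ne_of_lt (lt_of_eq_of_lt ?_ h2)
    refine setLIntegral_congr_fun measurableSet_Ioo fun t ht ↦ ?_
    dsimp only
    rw [Real.enorm_eq_ofReal (Real.rpow_nonneg ht.1.le _)]
  refine ⟨(ENNReal.ofReal c * (ENNReal.ofReal B ^ (2 * a) *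
    ∫⁻ t in Set.Ioo (0 : ℝ) 1, ENNReal.ofReal (t ^ γ))).toNNReal, fun f hf ↦ ?_⟩
  rw [ENNReal.coe_toNNReal (ENNReal.mul_ne_top ENNReal.ofReal_ne_top
    (ENNReal.mul_ne_top (ENNReal.rpow_ne_top_of_nonneg (by positivity) ENNReal.ofReal_ne_top) hfin))]
  have hfint : Integrable f μ := hf.integrable (by rwa [ENNReal.one_le_ofReal])
  have hcont := continuous_fourierOf hfint
  set N : ℝ≥0∞ := eLpNorm f (ENNReal.ofReal p) μ ^ 2 with hN
  have hNeq : (∫⁻ x, ‖f x‖ₑ ^ p ∂μ) ^ (2 / p) = N := by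
    rw [hN, eLpNorm_eq_lintegral_rpow_enorm_toReal (by simpa using hp0) ENNReal.ofReal_ne_top,
      ENNReal.toReal_ofReal hp0.le, ← ENNReal.rpow_natCast, ← ENNReal.rpow_mul]
    congr 1; push_cast; ring
  have hgauss : ∀ t ∈ Set.Ioo (0 : ℝ) 1, ENNReal.ofReal (t ^ (β - 1)) *
      ∫⁻ ξ, ‖fourierOf μ f ξ‖ₑ ^ 2 * ENNReal.ofReal (Real.exp (-(Real.pi * t) * ‖ξ‖ ^ 2)) ≤
      ENNReal.ofReal (t ^ γ) * (ENNReal.ofReal B ^ (2 * a) * N) := by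
    intro t ht
    have ht0 : 0 < t := ht.1
    have hY := lintegral_lintegral_mul_mul_le (μ := μ) hf.aestronglyMeasurable.enorm
      (k := fun x y ↦ ENNReal.ofReal (Real.exp (-Real.pi * ‖x - y‖ ^ 2 / t)))
      (by
        simp only [Function.uncurry_def]
        fun_prop)
      (fun x y ↦ by rw [norm_sub_rev])
      (fun x y ↦ by
        rw [ENNReal.ofReal_le_one, Real.exp_le_one_iff, neg_mul, neg_div]
        exact neg_nonpos.mpr (by positivity))
      (fun x ↦ hB x t ht0) hp1 hp2
    rw [hNeq] at hY
    calc _ ≤ ENNReal.ofReal (t ^ (β - 1)) * (ENNReal.ofReal (t ^ (-((d : ℝ) / 2))) *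
          (ENNReal.ofReal (B * t ^ (s / 2)) ^ (2 * a) * N)) := by
          gcongr
          exact (lintegral_sq_fourierOf_mul_gaussian_le hfint ht0).trans (by gcongr)
      _ = _ := by
          have e1 : ENNReal.ofReal (B * t ^ (s / 2)) ^ (2 * a) =
              ENNReal.ofReal B ^ (2 * a) * ENNReal.ofReal (t ^ (s * a)) := by
            rw [ENNReal.ofReal_mul hB0, ENNReal.mul_rpow_of_nonneg _ _ (by positivity),
              ENNReal.ofReal_rpow_of_nonneg (by positivity : 0 ≤ t ^ (s / 2)) (by positivity),
              ← Real.rpow_mul ht0.le]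
            ring_nf
          have e2 : ENNReal.ofReal (t ^ γ) = ENNReal.ofReal (t ^ (β - 1)) *
              ENNReal.ofReal (t ^ (-((d : ℝ) / 2))) * ENNReal.ofReal (t ^ (s * a)) := by
            rw [← ENNReal.ofReal_mul (by positivity), ← ENNReal.ofReal_mul (by positivity),
              ← Real.rpow_add ht0, ← Real.rpow_add ht0]
            rw [hγ]; ring_nf
          rw [e1, e2]; ring
  have hmeas : Measurable fun z : E d × ℝ ↦ ‖fourierOf μ f z.1‖ₑ ^ 2 *
      (ENNReal.ofReal (z.2 ^ (β - 1)) *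
        ENNReal.ofReal (Real.exp (-(Real.pi * z.2) * ‖z.1‖ ^ 2))) := by
    have := hcont.measurable
    fun_prop
  calc _ ≤ ∫⁻ ξ in {ξ | 1 ≤ ‖ξ‖}, ENNReal.ofReal c * ∫⁻ t in Set.Ioo (0 : ℝ) 1,
        ‖fourierOf μ f ξ‖ₑ ^ 2 * (ENNReal.ofReal (t ^ (β - 1)) *
          ENNReal.ofReal (Real.exp (-(Real.pi * t) * ‖ξ‖ ^ 2))) := by
        refine setLIntegral_mono' (measurableSet_le measurable_const measurable_norm) fun ξ hξ ↦ ?_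
        rw [lintegral_const_mul' _ _ (by simp), mul_left_comm]
        gcongr
        exact hc ξ hξ
    _ ≤ ∫⁻ ξ, ENNReal.ofReal c * ∫⁻ t in Set.Ioo (0 : ℝ) 1,
        ‖fourierOf μ f ξ‖ₑ ^ 2 * (ENNReal.ofReal (t ^ (β - 1)) *
          ENNReal.ofReal (Real.exp (-(Real.pi * t) * ‖ξ‖ ^ 2))) := setLIntegral_le_lintegral _ _
    _ = ENNReal.ofReal c * ∫⁻ t in Set.Ioo (0 : ℝ) 1, ENNReal.ofReal (t ^ (β - 1)) *
        ∫⁻ ξ, ‖fourierOf μ f ξ‖ₑ ^ 2 *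
          ENNReal.ofReal (Real.exp (-(Real.pi * t) * ‖ξ‖ ^ 2)) := by
        rw [lintegral_const_mul' _ _ ENNReal.ofReal_ne_top,
          lintegral_lintegral_swap hmeas.aemeasurable]
        congr 1
        refine lintegral_congr fun t ↦ ?_
        rw [← lintegral_const_mul' _ _ ENNReal.ofReal_ne_top]
        exact lintegral_congr fun ξ ↦ by ring
    _ ≤ ENNReal.ofReal c * ∫⁻ t in Set.Ioo (0 : ℝ) 1, ENNReal.ofReal (t ^ γ) *
          (ENNReal.ofReal B ^ (2 * a) * N) := by
        gcongr 1
        exact setLIntegral_mono' measurableSet_Ioo hgauss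
    _ = _ := by
        rw [lintegral_mul_const _ (by fun_prop)]
        ring

/-! ### Mollifiers, Fourier multipliers and regularised convolutions -/

namespace Mollifier

variable (φ : Mollifier d)

/-- The Fourier transform of a mollifier. -/
def hat (ξ : E d) : ℂ := 𝓕 (fun y : E d ↦ (φ.toFun y : ℂ)) ξ

theorem integrable : Integrable φ.toFun :=
  φ.smooth.continuous.integrable_of_hasCompactSupport φ.compactSupport

theorem continuous_hat : Continuous φ.hat :=
  continuous_fourierOf (μ := volume) φ.integrable.ofReal

theorem hat_zero : φ.hat 0 = 1 := by
  have := φ.integral_eq_one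
  rw [hat, Real.fourier_eq]
  simp only [inner_zero_right, neg_zero, AddChar.map_zero_eq_one, one_smul]
  rw [integral_complex_ofReal, this, Complex.ofReal_one]

theorem norm_hat_le (ξ : E d) : ‖φ.hat ξ‖ ≤ 1 := by
  have := norm_fourierOf_le volume (fun y : E d ↦ (φ.toFun y : ℂ)) ξ
  refine (le_of_eq rfl).trans (this.trans (le_of_eq ?_))
  simp only [Complex.norm_real, Real.norm_eq_abs, abs_of_nonneg (φ.nonneg _)]
  exact φ.integral_eq_one

/-- The inverse transform is the relevant one because Λ(ψ) is the Fourier transform of Λ tested on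
the inverse transform of ψ. The substitutions y ↦ z - y and y ↦ y/ε turn it into a character times a
dilated symbol. -/
theorem fourierInv_shiftedSchwartz {ε : ℝ} (hε : 0 < ε) (z ξ : E d) :
    𝓕⁻ (φ.shiftedSchwartz hε z) ξ = Real.fourierChar (inner ℝ z ξ) • φ.hat (ε • ξ) := by
  rw [SchwartzMap.fourierInv_coe, Real.fourierInv_eq]
  have h0 : ∀ y, (φ.shiftedSchwartz hε z) y = ((φ.scaled ε (z - y) : ℝ) : ℂ) := fun y ↦ rfl
  simp only [h0]
  have h1 : ∫ y, Real.fourierChar (inner ℝ y ξ) • ((φ.scaled ε (z - y) : ℝ) : ℂ) =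
      ∫ y, Real.fourierChar (inner ℝ (z - y) ξ) • ((φ.scaled ε y : ℝ) : ℂ) := by
    rw [← integral_sub_left_eq_self _ volume z]
    simp only [sub_sub_cancel]
  set F : E d → ℂ := fun w ↦ Real.fourierChar (-inner ℝ w (ε • ξ)) • (φ.toFun w : ℂ) with hF
  have h2 : ∀ y, Real.fourierChar (inner ℝ (z - y) ξ) • ((φ.scaled ε y : ℝ) : ℂ) =
      Real.fourierChar (inner ℝ z ξ) • (((ε ^ d : ℝ) : ℂ)⁻¹ * F (ε⁻¹ • y)) := by
    intro y
    have e1 : inner ℝ (ε⁻¹ • y) (ε • ξ) = inner ℝ y ξ := by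
      rw [real_inner_smul_left, real_inner_smul_right]; field_simp
    rw [inner_sub_left, sub_eq_add_neg, AddChar.map_add_eq_mul, mul_smul]
    simp only [hF, e1, scaled, Circle.smul_def, smul_eq_mul]
    push_cast
    ring
  have h3 : φ.hat (ε • ξ) = ∫ w, F w := by rw [hat, Real.fourier_eq]
  have hεd : (0 : ℝ) < ε ^ d := by positivity
  have hεc : ((ε ^ d : ℝ) : ℂ) ≠ 0 := by exact_mod_cast hεd.ne'
  rw [h1, h3]
  simp only [h2, Circle.smul_def, smul_eq_mul]
  rw [integral_const_mul, integral_const_mul, Measure.integral_comp_smul,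
    finrank_euclideanSpace_fin, inv_pow, inv_inv, abs_of_pos hεd, Complex.real_smul,
    inv_mul_cancel_left₀ hεc]

end Mollifier

/-- The image of `f μ` under the Fourier multiplier with symbol `m`. -/
def multiplierConv (m : E d → ℂ) (μ : Measure (E d)) (f : E d → ℂ) (x : E d) : ℂ :=
  fourierOf volume (fun ξ ↦ m ξ * fourierOf μ f ξ) (-x)

theorem integrable_mul_fourierOf {m : E d → ℂ} (hm : Integrable m) {μ : Measure (E d)}
    {f : E d → ℂ} (hf : Integrable f μ) : Integrable fun ξ ↦ m ξ * fourierOf μ f ξ :=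
  hm.mul_bdd (continuous_fourierOf hf).aestronglyMeasurable
    (ae_of_all _ fun ξ ↦ norm_fourierOf_le μ f ξ)

theorem continuous_multiplierConv {m : E d → ℂ} (hm : Integrable m) {μ : Measure (E d)}
    {f : E d → ℂ} (hf : Integrable f μ) : Continuous (multiplierConv m μ f) :=
  (continuous_fourierOf (integrable_mul_fourierOf hm hf)).comp continuous_neg

theorem norm_multiplierConv_le (m : E d → ℂ) (μ : Measure (E d)) (f : E d → ℂ) (x : E d) :
    ‖multiplierConv m μ f x‖ ≤ ∫ ξ, ‖m ξ * fourierOf μ f ξ‖ :=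
  norm_fourierOf_le _ _ _

theorem memLp_multiplierConv {m : E d → ℂ} (hm : Integrable m) {μ : Measure (E d)}
    [IsFiniteMeasure μ] {f : E d → ℂ} (hf : Integrable f μ) (q : ℝ≥0∞) :
    MemLp (multiplierConv m μ f) q μ :=
  MemLp.of_bound (continuous_multiplierConv hm hf).aestronglyMeasurable _
    (ae_of_all _ (norm_multiplierConv_le m μ f))

theorem multiplierConv_sub {m₁ m₂ : E d → ℂ} (hm₁ : Integrable m₁) (hm₂ : Integrable m₂)
    {μ : Measure (E d)} {f : E d → ℂ} (hf : Integrable f μ) (x : E d) :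
    multiplierConv (fun ξ ↦ m₁ ξ - m₂ ξ) μ f x =
      multiplierConv m₁ μ f x - multiplierConv m₂ μ f x := by
  have hi : ∀ {m : E d → ℂ}, Integrable m → Integrable fun ξ ↦
      Real.fourierChar (-(innerₗ (E d)) ξ (-x)) • (m ξ * fourierOf μ f ξ) := fun {m} hm ↦
    (VectorFourier.fourierIntegral_convergent_iff Real.continuous_fourierChar
      continuous_innerₗ_uncurry (-x)).mpr (integrable_mul_fourierOf hm hf)
  refine Eq.trans ?_ (integral_sub (hi hm₁) (hi hm₂))
  refine integral_congr_ae (ae_of_all _ fun ξ ↦ ?_)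
  simp only [sub_mul, smul_sub]

/-- Fubini identifies the multiplier with convolution against the inverse transform of its symbol;
for the symbol m(ξ) φ̂(εξ) this kernel is `mollify`. -/
theorem multiplierConv_eq_integral {m : E d → ℂ} (hm : Integrable m) {μ : Measure (E d)}
    [IsFiniteMeasure μ] {f : E d → ℂ} (hf : Integrable f μ) (x : E d) :
    multiplierConv m μ f x =
      ∫ y, (∫ ξ, Real.fourierChar (inner ℝ (x - y) ξ) • m ξ) * f y ∂μ := by
  have hcx : Continuous fun ξ : E d ↦ Real.fourierChar (inner ℝ x ξ) :=
    Real.continuous_fourierChar.comp (by fun_prop)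
  have hg : Integrable fun ξ ↦ Real.fourierChar (inner ℝ x ξ) • m ξ :=
    hm.mono (hcx.aestronglyMeasurable.smul hm.aestronglyMeasurable)
      (ae_of_all _ fun ξ ↦ by simp [Circle.norm_smul])
  have := VectorFourier.integral_fourierIntegral_smul_eq_flip (μ := μ) (ν := volume)
    (L := innerₗ (E d)) (f := f) (g := fun ξ ↦ Real.fourierChar (inner ℝ x ξ) • m ξ)
    Real.continuous_fourierChar continuous_innerₗ_uncurry hf hg
  simp only [smul_eq_mul, flip_innerₗ] at this
  calc _ = ∫ ξ, fourierOf μ f ξ * (Real.fourierChar (inner ℝ x ξ) • m ξ) := by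
        simp only [multiplierConv, fourierOf, VectorFourier.fourierIntegral, innerₗ_apply_apply,
          inner_neg_right, neg_neg, real_inner_comm _ x]
        refine integral_congr_ae (ae_of_all _ fun ξ ↦ ?_)
        simp only [Circle.smul_def, smul_eq_mul]
        ring
    _ = _ := this
    _ = _ := by
        refine integral_congr_ae (ae_of_all _ fun y ↦ ?_)
        simp only [VectorFourier.fourierIntegral, innerₗ_apply_apply]
        rw [mul_comm]
        congr 1
        refine integral_congr_ae (ae_of_all _ fun ξ ↦ ?_)
        beta_reduce
        rw [inner_sub_left, sub_eq_add_neg, AddChar.map_add_eq_mul, mul_comm, mul_smul,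
          real_inner_comm y]

/-- A Parseval identity, which converts an L^q(μ) bound by duality into an estimate on the Fourier
side. -/
theorem integral_multiplierConv_mul_conj {m : E d → ℂ} (hm : Integrable m) {μ : Measure (E d)}
    [IsFiniteMeasure μ] {f g : E d → ℂ} (hf : Integrable f μ) (hg : Integrable g μ) :
    ∫ x, multiplierConv m μ f x * (starRingEnd ℂ) (g x) ∂μ =
      ∫ ξ, m ξ * fourierOf μ f ξ * (starRingEnd ℂ) (fourierOf μ g ξ) := by
  have := VectorFourier.integral_sesq_fourierIntegral_eq_neg_flip (μ := μ) (ν := volume)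
    (L := innerₗ (E d)) (f := g) (g := fun ξ ↦ m ξ * fourierOf μ f ξ)
    (innerSL ℂ (E := ℂ)) Real.continuous_fourierChar continuous_innerₗ_uncurry hg
    (integrable_mul_fourierOf hm hf)
  simp only [innerSL_apply_apply, RCLike.inner_apply] at this
  refine Eq.trans ?_ this.symm
  refine integral_congr_ae (ae_of_all _ fun x ↦ ?_)
  simp only [multiplierConv, fourierOf, VectorFourier.fourierIntegral, LinearMap.neg_apply,
    flip_innerₗ, neg_neg, innerₗ_apply_apply, inner_neg_right, real_inner_comm x]

/-- A function bounded by a power at infinity is integrable against Schwartz functions. -/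
theorem integrable_mul_schwartz {m : E d → ℂ} (hm : LocallyIntegrable m) {C α : ℝ}
    (hC : ∀ᵐ ξ, ‖m ξ‖ ≤ C * ‖ξ‖ ^ (-α)) (v : 𝓢(E d, ℂ)) : Integrable fun ξ ↦ m ξ * v ξ := by
  set k : ℕ := ⌈|α|⌉₊
  have hmeas : AEStronglyMeasurable (fun ξ ↦ m ξ * v ξ) volume :=
    hm.aestronglyMeasurable.mul v.continuous.aestronglyMeasurable
  have h1 : IntegrableOn (fun ξ ↦ m ξ * v ξ) (Metric.closedBall 0 1) := by
    have := hm.integrableOn_isCompact (isCompact_closedBall (0 : E d) 1)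
    exact this.mul_continuousOn v.continuous.continuousOn (isCompact_closedBall (0 : E d) 1)
  have h2 : IntegrableOn (fun ξ ↦ m ξ * v ξ) (Metric.closedBall 0 1)ᶜ := by
    refine Integrable.mono' (((v.integrable_pow_mul volume k).const_mul |C|).integrableOn)
      hmeas.restrict ?_
    filter_upwards [ae_restrict_of_ae hC,
      ae_restrict_mem Metric.isClosed_closedBall.measurableSet.compl] with ξ hξ hmem
    have hξ1 : 1 ≤ ‖ξ‖ := by
      simp only [Set.mem_compl_iff, Metric.mem_closedBall, dist_zero_right, not_le] at hmem
      exact hmem.le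
    rw [norm_mul, ← mul_assoc]
    gcongr
    calc ‖m ξ‖ ≤ C * ‖ξ‖ ^ (-α) := hξ
      _ ≤ |C| * ‖ξ‖ ^ (-α) := by gcongr; exact le_abs_self C
      _ ≤ |C| * ‖ξ‖ ^ k := by
        rw [← Real.rpow_natCast]
        gcongr
        exact (neg_le_abs α).trans (Nat.le_ceil _)
  have := h1.union h2
  rwa [Set.union_compl_self, integrableOn_univ] at this

theorem mollify_eq_integral {Λ : 𝓢'(E d, ℂ)} {m : E d → ℂ}
    (hΛ : ∀ ψ : 𝓢(E d, ℂ), 𝓕 Λ ψ = ∫ ξ, m ξ * ψ ξ) (φ : Mollifier d) {ε : ℝ} (hε : 0 < ε)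
    (z : E d) : mollify Λ φ ε z =
      ∫ ξ, Real.fourierChar (inner ℝ z ξ) • (m ξ * φ.hat (ε • ξ)) := by
  rw [mollify, dif_pos hε]
  have : Λ (φ.shiftedSchwartz hε z) = 𝓕 Λ (𝓕⁻ (φ.shiftedSchwartz hε z)) := by
    rw [TemperedDistribution.fourier_apply, FourierTransform.fourier_fourierInv_eq]
  rw [this, hΛ]
  refine integral_congr_ae (ae_of_all _ fun ξ ↦ ?_)
  beta_reduce
  rw [φ.fourierInv_shiftedSchwartz hε, mul_smul_comm]

theorem regConv_eq_multiplierConv {Λ : 𝓢'(E d, ℂ)} {m : E d → ℂ}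
    (hΛ : ∀ ψ : 𝓢(E d, ℂ), 𝓕 Λ ψ = ∫ ξ, m ξ * ψ ξ) (φ : Mollifier d) {ε : ℝ} (hε : 0 < ε)
    (hint : Integrable fun ξ ↦ m ξ * φ.hat (ε • ξ)) {μ : Measure (E d)} [IsFiniteMeasure μ]
    {f : E d → ℂ} (hf : Integrable f μ) (x : E d) :
    regConv Λ φ μ ε f x = multiplierConv (fun ξ ↦ m ξ * φ.hat (ε • ξ)) μ f x := by
  rw [multiplierConv_eq_integral hint hf, regConv]
  simp only [mollify_eq_integral hΛ φ hε]

theorem integrable_mul_hat {m : E d → ℂ} (hm : LocallyIntegrable m) {C α : ℝ}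
    (hC : ∀ᵐ ξ, ‖m ξ‖ ≤ C * ‖ξ‖ ^ (-α)) (φ : Mollifier d) {ε : ℝ} (hε : 0 < ε) :
    Integrable fun ξ ↦ m ξ * φ.hat (ε • ξ) := by
  -- At z = 0 the character is trivial, so the dilated symbol is itself a Schwartz function.
  refine (integrable_mul_schwartz hm hC (𝓕⁻ (φ.shiftedSchwartz hε 0))).congr
    (ae_of_all _ fun ξ ↦ ?_)
  simp [φ.fourierInv_shiftedSchwartz hε]

/-! ### Duality, frequency weights and Cauchy–Schwarz -/

/-- Bounding an `L^q` norm by duality. -/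
theorem eLpNorm_le_of_forall_enorm_integral_le {α : Type*} [MeasurableSpace α] {μ : Measure α}
    [IsFiniteMeasure μ] {h : α → ℂ} (hh : AEStronglyMeasurable h μ) {M : ℝ}
    (hM : ∀ x, ‖h x‖ ≤ M) {q q' : ℝ} (hq : q.HolderConjugate q') {N : ℝ≥0∞}
    (hN : ∀ g : α → ℂ, MemLp g (ENNReal.ofReal q') μ →
      ‖∫ x, h x * (starRingEnd ℂ) (g x) ∂μ‖ₑ ≤ N * eLpNorm g (ENNReal.ofReal q') μ) :
    eLpNorm h (ENNReal.ofReal q) μ ≤ N := by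
  have hq1 : 1 < q := hq.lt
  have hq0 : 0 < q := hq.pos
  have hq0' : 0 < q' := hq.symm.pos
  have hconj : (q - 1) * q' = q := hq.sub_one_mul_conj
  -- The extremal function |h|^(q-2) h: its pairing with h is the integral of |h|^q, and |g|^q' =
  -- |h|^q.
  set g : α → ℂ := fun x ↦ ((‖h x‖ ^ (q - 2) : ℝ) : ℂ) * h x with hg
  have hgn : ∀ x, ‖g x‖ = ‖h x‖ ^ (q - 1) := by
    intro x
    rw [hg, norm_mul, Complex.norm_real, Real.norm_eq_abs, abs_of_nonneg (by positivity)]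
    rcases eq_or_ne (‖h x‖) 0 with h0 | h0
    · rw [h0, mul_zero, Real.zero_rpow (by linarith)]
    · conv_lhs => rw [← Real.rpow_one (‖h x‖), ← Real.rpow_mul (by positivity),
        ← Real.rpow_add (by positivity)]
      congr 1; ring
  have hgm : AEStronglyMeasurable g μ := by
    refine AEStronglyMeasurable.mul ?_ hh
    exact (hh.norm.aemeasurable.pow_const _).complex_ofReal.aestronglyMeasurable
  have hgL : MemLp g (ENNReal.ofReal q') μ :=
    MemLp.of_bound hgm (M ^ (q - 1)) (ae_of_all _ fun x ↦ by
      rw [hgn]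
      exact Real.rpow_le_rpow (norm_nonneg _) (hM x) (by linarith))
  have hge : ∀ x, ‖g x‖ₑ ^ q' = ‖h x‖ₑ ^ q := by
    intro x
    rw [← ofReal_norm, hgn, ← ofReal_norm, ENNReal.ofReal_rpow_of_nonneg (by positivity) hq0'.le,
      ← Real.rpow_mul (norm_nonneg _), hconj,
      ENNReal.ofReal_rpow_of_nonneg (by positivity) hq0.le]
  set I : ℝ≥0∞ := ∫⁻ x, ‖h x‖ₑ ^ q ∂μ with hI
  have hnorm : eLpNorm h (ENNReal.ofReal q) μ = I ^ (1 / q) := by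
    rw [eLpNorm_eq_lintegral_rpow_enorm_toReal (by simpa using hq0) ENNReal.ofReal_ne_top,
      ENNReal.toReal_ofReal hq0.le]
  have hgnorm : eLpNorm g (ENNReal.ofReal q') μ = I ^ (1 / q') := by
    rw [eLpNorm_eq_lintegral_rpow_enorm_toReal (by simpa using hq0') ENNReal.ofReal_ne_top,
      ENNReal.toReal_ofReal hq0'.le]
    simp only [hge, hI]
  -- Since h is bounded and μ finite, I is finite, which permits the final cancellation of I^(1/q').
  have hItop : I ≠ ⊤ := by
    have := (MemLp.of_bound hh M (ae_of_all _ hM) : MemLp h (ENNReal.ofReal q) μ).2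
    rw [hnorm] at this
    intro h0
    rw [h0, ENNReal.top_rpow_of_pos (by positivity)] at this
    exact lt_irrefl _ this
  have hint : ‖∫ x, h x * (starRingEnd ℂ) (g x) ∂μ‖ₑ = I := by
    have hpt : ∀ x, h x * (starRingEnd ℂ) (g x) = ((‖h x‖ ^ q : ℝ) : ℂ) := by
      intro x
      rw [hg]
      simp only [map_mul, Complex.conj_ofReal]
      rw [mul_left_comm, Complex.mul_conj']
      norm_cast
      rcases eq_or_ne (‖h x‖) 0 with h0 | h0
      · rw [h0, Real.zero_rpow hq0.ne']; ring
      · rw [← Real.rpow_natCast, ← Real.rpow_add (by positivity)]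
        congr 1; push_cast; ring
    simp_rw [hpt]
    have hi : Integrable (fun x ↦ ‖h x‖ ^ q) μ :=
      Integrable.of_bound (hh.norm.aemeasurable.pow_const _).aestronglyMeasurable (M ^ q)
        (ae_of_all _ fun x ↦ by
          rw [Real.norm_eq_abs, abs_of_nonneg (by positivity)]
          exact Real.rpow_le_rpow (norm_nonneg _) (hM x) hq0.le)
    rw [integral_complex_ofReal, ← ofReal_norm, Complex.norm_real, Real.norm_eq_abs,
      abs_of_nonneg (integral_nonneg fun x ↦ by positivity),
      ofReal_integral_eq_lintegral_ofReal hi (ae_of_all _ fun x ↦ by positivity)]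
    refine lintegral_congr fun x ↦ ?_
    rw [← ofReal_norm, ENNReal.ofReal_rpow_of_nonneg (by positivity) hq0.le]
  have key := hN g hgL
  rw [hint, hgnorm] at key
  rw [hnorm]
  rcases eq_or_ne I 0 with h0 | h0
  · rw [h0, ENNReal.zero_rpow_of_pos (by positivity)]; exact zero_le
  · have hI' : I = I ^ (1 / q) * I ^ (1 / q') := by
      rw [← ENNReal.rpow_add _ _ h0 hItop, one_div, one_div, hq.inv_add_inv_eq_one,
        ENNReal.rpow_one]
    have hpos : I ^ (1 / q') ≠ 0 := by simp [h0, hItop]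
    have hne : I ^ (1 / q') ≠ ⊤ := ENNReal.rpow_ne_top_of_nonneg (by positivity) hItop
    conv_lhs at key => rw [hI']
    exact (ENNReal.mul_le_mul_iff_left hpos hne).mp key

/-- The weight `|m|` at low frequencies and `|ξ|^{-2β}` at high frequencies. -/
def weight (m : E d → ℂ) (β : ℝ) (ξ : E d) : ℝ≥0∞ :=
  ({ξ | 1 ≤ ‖ξ‖}ᶜ).indicator (fun ξ ↦ ‖m ξ‖ₑ) ξ +
    ({ξ | 1 ≤ ‖ξ‖}).indicator (fun ξ ↦ ENNReal.ofReal (‖ξ‖ ^ (-(2 * β)))) ξ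

theorem measurableSet_one_le_norm : MeasurableSet {ξ : E d | 1 ≤ ‖ξ‖} :=
  measurableSet_le measurable_const measurable_norm

theorem aemeasurable_weight {m : E d → ℂ} (hm : AEStronglyMeasurable m volume) (β : ℝ) :
    AEMeasurable (weight m β) volume :=
  (hm.enorm.indicator measurableSet_one_le_norm.compl).add
    (Measurable.indicator (by fun_prop) measurableSet_one_le_norm).aemeasurable

/-- At high frequency the square roots of the weights multiply to |ξ|^(-β₁-β₂) = |ξ|^(-α). At low
frequency both weights equal |m|, so the product is |m| itself and no decay is used. The constant
`max C 1` covers both ranges. -/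
theorem enorm_le_weight_mul_weight {m : E d → ℂ} {C α β₁ β₂ : ℝ} (hβ : β₁ + β₂ = α)
    (hC : ∀ᵐ ξ, ‖m ξ‖ ≤ C * ‖ξ‖ ^ (-α)) :
    ∀ᵐ ξ, ‖m ξ‖ₑ ≤ ENNReal.ofReal (max C 1) *
      (weight m β₁ ξ ^ (1 / 2 : ℝ) * weight m β₂ ξ ^ (1 / 2 : ℝ)) := by
  filter_upwards [hC] with ξ hξ
  by_cases h : 1 ≤ ‖ξ‖
  · have hpos : 0 < ‖ξ‖ := by linarith
    have hw : ∀ β, weight m β ξ ^ (1 / 2 : ℝ) = ENNReal.ofReal (‖ξ‖ ^ (-β)) := by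
      intro β
      simp only [weight, Set.indicator, Set.mem_compl_iff, Set.mem_ofPred_eq, h, not_true_eq_false,
        if_false, if_true, zero_add]
      rw [ENNReal.ofReal_rpow_of_nonneg (by positivity) (by norm_num), ← Real.rpow_mul hpos.le]
      congr 2; ring
    rw [hw, hw, ← ENNReal.ofReal_mul (by positivity), ← ENNReal.ofReal_mul (by positivity),
      ← Real.rpow_add hpos, ← ofReal_norm]
    refine ENNReal.ofReal_le_ofReal (hξ.trans ?_)
    rw [← hβ, neg_add]
    gcongr
    exact le_max_left _ _
  · have hw : ∀ β, weight m β ξ = ‖m ξ‖ₑ := by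
      intro β
      simp [weight, Set.indicator, h]
    rw [hw, hw, ← ENNReal.rpow_add_of_nonneg _ _ (by norm_num) (by norm_num)]
    norm_num
    refine le_mul_of_one_le_left zero_le ?_
    exact le_max_right _ _

theorem lintegral_mul_weight (m : E d → ℂ) (β : ℝ) (F : E d → ℝ≥0∞) :
    ∫⁻ ξ, F ξ * weight m β ξ = (∫⁻ ξ in {ξ | 1 ≤ ‖ξ‖}ᶜ, F ξ * ‖m ξ‖ₑ) +
      ∫⁻ ξ in {ξ | 1 ≤ ‖ξ‖}, F ξ * ENNReal.ofReal (‖ξ‖ ^ (-(2 * β))) := by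
  rw [← lintegral_add_compl _ measurableSet_one_le_norm, add_comm]
  congr 1
  · refine setLIntegral_congr_fun measurableSet_one_le_norm.compl fun ξ hξ ↦ ?_
    have h : ¬ 1 ≤ ‖ξ‖ := hξ
    simp [weight, Set.indicator, h]
  · refine setLIntegral_congr_fun measurableSet_one_le_norm fun ξ hξ ↦ ?_
    have h : 1 ≤ ‖ξ‖ := hξ
    simp [weight, Set.indicator, h]

theorem lintegral_enorm_lowFrequency_lt_top {m : E d → ℂ} (hm : LocallyIntegrable m) :
    ∫⁻ ξ in {ξ | 1 ≤ ‖ξ‖}ᶜ, ‖m ξ‖ₑ < ⊤ := by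
  have := (hm.integrableOn_isCompact (isCompact_closedBall (0 : E d) 1)).hasFiniteIntegral
  refine lt_of_le_of_lt (lintegral_mono_set fun ξ hξ ↦ ?_) this
  simp only [Set.mem_compl_iff, Set.mem_ofPred_eq, not_le] at hξ
  simpa using hξ.le

/-- High frequencies are the restriction estimate. At low frequencies |F(f)| ≤ ‖f‖_1, which is at
most a power of the total mass times ‖f‖_p, and |m| is integrable on the unit ball. -/
theorem exists_lintegral_sq_fourierOf_mul_weight_le {m : E d → ℂ} (hm : LocallyIntegrable m)
    {μ : Measure (E d)} [IsFiniteMeasure μ] {s C : ℝ} (hC : 0 ≤ C)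
    (hμ : ∀ (x : E d) (r : ℝ), 0 < r → μ (Metric.ball x r) ≤ ENNReal.ofReal (C * r ^ s))
    {p β : ℝ} (hp1 : 1 ≤ p) (hp2 : p ≤ 2) (hβ : (d : ℝ) / 2 - s * (1 - 1 / p) < β) :
    ∃ K : ℝ≥0, ∀ f : E d → ℂ, MemLp f (ENNReal.ofReal p) μ →
      ∫⁻ ξ, ‖fourierOf μ f ξ‖ₑ ^ 2 * weight m β ξ ≤
        K * eLpNorm f (ENNReal.ofReal p) μ ^ 2 := by
  obtain ⟨K, hK⟩ := exists_lintegral_sq_fourierOf_le hC hμ hp1 hp2 hβ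
  have hp1' : 1 ≤ ENNReal.ofReal p := by rwa [ENNReal.one_le_ofReal]
  have hp0 : 0 < p := by linarith
  set V : ℝ≥0∞ := μ Set.univ ^ (1 - 1 / p) with hV
  have hVtop : V ≠ ⊤ := ENNReal.rpow_ne_top_of_nonneg
    (by rw [sub_nonneg, div_le_one hp0]; exact hp1) (measure_ne_top _ _)
  set J : ℝ≥0∞ := ∫⁻ ξ in {ξ | 1 ≤ ‖ξ‖}ᶜ, ‖m ξ‖ₑ with hJ
  have hJtop : J ≠ ⊤ := (lintegral_enorm_lowFrequency_lt_top hm).ne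
  refine ⟨(V ^ 2 * J).toNNReal + K, fun f hf ↦ ?_⟩
  have hfint : Integrable f μ := hf.integrable hp1'
  rw [lintegral_mul_weight, ENNReal.coe_add,
    ENNReal.coe_toNNReal (ENNReal.mul_ne_top (ENNReal.pow_ne_top hVtop) hJtop), add_mul]
  refine add_le_add ?_ (hK f hf)
  have hb : ∀ ξ, ‖fourierOf μ f ξ‖ₑ ≤ V * eLpNorm f (ENNReal.ofReal p) μ := by
    intro ξ
    calc ‖fourierOf μ f ξ‖ₑ = ENNReal.ofReal ‖fourierOf μ f ξ‖ := (ofReal_norm _).symm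
      _ ≤ ENNReal.ofReal (∫ x, ‖f x‖ ∂μ) := ENNReal.ofReal_le_ofReal (norm_fourierOf_le μ f ξ)
      _ = eLpNorm f 1 μ := by
        rw [ofReal_integral_norm_eq_lintegral_enorm hfint, eLpNorm_one_eq_lintegral_enorm]
      _ ≤ _ := by
        have := eLpNorm_le_eLpNorm_mul_rpow_measure_univ hp1' hf.aestronglyMeasurable
        rw [ENNReal.toReal_ofReal hp0.le] at this
        simpa [hV, mul_comm] using this
  calc _ ≤ ∫⁻ ξ in {ξ | 1 ≤ ‖ξ‖}ᶜ, (V * eLpNorm f (ENNReal.ofReal p) μ) ^ 2 * ‖m ξ‖ₑ := by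
        gcongr with ξ
        exact hb ξ
    _ = _ := by
        rw [lintegral_const_mul'' _ hm.aestronglyMeasurable.enorm.restrict, mul_pow]
        ring

/-- Cauchy–Schwarz with the extra symbol u kept beside F, so that replacing u by a difference of
mollifier symbols makes that factor small while the factor with G stays bounded. -/
theorem lintegral_enorm_mul_le_weight {m : E d → ℂ} (hm : AEStronglyMeasurable m volume)
    {C α β₁ β₂ : ℝ} (hβ : β₁ + β₂ = α) (hC : ∀ᵐ ξ, ‖m ξ‖ ≤ C * ‖ξ‖ ^ (-α))
    {u F G : E d → ℝ≥0∞} (hu : Measurable u) (hF : Measurable F) (hG : Measurable G) :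
    ∫⁻ ξ, ‖m ξ‖ₑ * u ξ * F ξ * G ξ ≤ ENNReal.ofReal (max C 1) *
      ((∫⁻ ξ, u ξ ^ 2 * (F ξ ^ 2 * weight m β₁ ξ)) ^ (1 / 2 : ℝ) *
        (∫⁻ ξ, G ξ ^ 2 * weight m β₂ ξ) ^ (1 / 2 : ℝ)) := by
  have hsq : ∀ x : ℝ≥0∞, (x ^ (1 / 2 : ℝ)) ^ (2 : ℝ) = x := fun x ↦ by
    rw [← ENNReal.rpow_mul]; norm_num
  have hw₁ := aemeasurable_weight hm β₁
  have hw₂ := aemeasurable_weight hm β₂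
  calc _ ≤ ∫⁻ ξ, ENNReal.ofReal (max C 1) * ((u ξ * F ξ * weight m β₁ ξ ^ (1 / 2 : ℝ)) *
        (G ξ * weight m β₂ ξ ^ (1 / 2 : ℝ))) := by
        refine lintegral_mono_ae ?_
        filter_upwards [enorm_le_weight_mul_weight hβ hC] with ξ hξ
        calc _ ≤ _ := mul_le_mul_left (mul_le_mul_left (mul_le_mul_left hξ _) _) _
          _ = _ := by ring
    _ = ENNReal.ofReal (max C 1) * ∫⁻ ξ, (u ξ * F ξ * weight m β₁ ξ ^ (1 / 2 : ℝ)) *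
        (G ξ * weight m β₂ ξ ^ (1 / 2 : ℝ)) := lintegral_const_mul' _ _ ENNReal.ofReal_ne_top
    _ ≤ _ := by
        gcongr
        refine (ENNReal.lintegral_mul_le_Lp_mul_Lq volume Real.HolderConjugate.two_two
          (f := fun ξ ↦ u ξ * F ξ * weight m β₁ ξ ^ (1 / 2 : ℝ))
          (g := fun ξ ↦ G ξ * weight m β₂ ξ ^ (1 / 2 : ℝ))
          ((hu.mul hF).aemeasurable.mul (hw₁.pow_const _))
          (hG.aemeasurable.mul (hw₂.pow_const _))).trans (le_of_eq ?_)
        simp only [ENNReal.mul_rpow_of_nonneg _ _ (zero_le_two : (0 : ℝ) ≤ 2), hsq,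
          ENNReal.rpow_two, mul_assoc]

/-! ### Convergence of the regularised convolutions -/

/-- The symbol is continuous with value 1 at the origin and modulus at most 1, so dominated
convergence applies with majorant 4w. -/
theorem tendsto_lintegral_sq_hat_sub_one (φ : Mollifier d) {w : E d → ℝ≥0∞}
    (hw : AEMeasurable w volume) (hwi : ∫⁻ ξ, w ξ ≠ ⊤) :
    Tendsto (fun ε : ℝ ↦ ∫⁻ ξ, ‖φ.hat (ε • ξ) - 1‖ₑ ^ 2 * w ξ) (𝓝[>] 0) (𝓝 0) := by
  have hb : ∀ ξ, ‖φ.hat ξ - 1‖ₑ ≤ 2 := fun ξ ↦ by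
    calc ‖φ.hat ξ - 1‖ₑ ≤ ‖φ.hat ξ‖ₑ + ‖(1 : ℂ)‖ₑ := enorm_sub_le
      _ ≤ 1 + 1 := by
        gcongr
        · rw [← ofReal_norm, ENNReal.ofReal_le_one]; exact φ.norm_hat_le ξ
        · simp
      _ = 2 := by norm_num
  have h0 : ∫⁻ ξ, (0 : E d → ℝ≥0∞) ξ = 0 := by simp
  rw [← h0]
  have hc : Continuous φ.hat := φ.continuous_hat
  refine tendsto_lintegral_filter_of_dominated_convergence' (fun ξ ↦ 2 ^ 2 * w ξ) ?_ ?_ ?_ ?_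
  · refine Eventually.of_forall fun ε ↦ AEMeasurable.mul ?_ hw
    have : Continuous fun ξ : E d ↦ φ.hat (ε • ξ) - 1 := by fun_prop
    exact (this.measurable.enorm.pow_const 2).aemeasurable
  · exact Eventually.of_forall fun ε ↦ ae_of_all _ fun ξ ↦ by gcongr; exact hb _
  · rw [lintegral_const_mul'' _ hw]
    exact ENNReal.mul_ne_top (by norm_num) hwi
  · filter_upwards [ae_lt_top' hw hwi] with ξ hξ
    have h1 : Tendsto (fun ε : ℝ ↦ ‖φ.hat (ε • ξ) - 1‖ₑ ^ 2) (𝓝[>] 0) (𝓝 0) := by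
      have : Continuous fun ε : ℝ ↦ ‖φ.hat (ε • ξ) - 1‖ₑ ^ 2 :=
        (ENNReal.continuous_pow 2).comp (by fun_prop)
      have h2 := (this.tendsto 0).mono_left (nhdsWithin_le_nhds (s := Set.Ioi 0))
      simpa [φ.hat_zero] using h2
    have h3 := ENNReal.Tendsto.mul_const h1 (Or.inr hξ.ne)
    simpa using h3

theorem enorm_sub_sq_le (a b c : ℂ) : ‖a - b‖ₑ ^ 2 ≤ 2 * (‖a - c‖ₑ ^ 2 + ‖b - c‖ₑ ^ 2) := by
  have h : ‖a - b‖ ^ 2 ≤ 2 * (‖a - c‖ ^ 2 + ‖b - c‖ ^ 2) := by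
    have h1 : ‖a - b‖ ≤ ‖a - c‖ + ‖b - c‖ := by
      calc ‖a - b‖ = ‖(a - c) - (b - c)‖ := by ring_nf
        _ ≤ _ := norm_sub_le _ _
    nlinarith [sq_nonneg (‖a - c‖ - ‖b - c‖), norm_nonneg (a - b), norm_nonneg (a - c),
      norm_nonneg (b - c)]
  have h2 := ENNReal.ofReal_le_ofReal h
  rwa [ENNReal.ofReal_mul zero_le_two, ENNReal.ofReal_add (by positivity) (by positivity),
    ENNReal.ofReal_pow (norm_nonneg _), ENNReal.ofReal_pow (norm_nonneg _),
    ENNReal.ofReal_pow (norm_nonneg _), ofReal_norm, ofReal_norm, ofReal_norm,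
    ENNReal.ofReal_ofNat] at h2

/-- If multipliers `m u` are bounded in `L^q(μ)` by a weighted `L²` norm of `u`, then the
regularised convolutions converge. -/
theorem convBounded_of_multiplier_estimate {Λ : 𝓢'(E d, ℂ)} {m : E d → ℂ}
    (hΛ : ∀ ψ : 𝓢(E d, ℂ), 𝓕 Λ ψ = ∫ ξ, m ξ * ψ ξ) (hm : LocallyIntegrable m) {C α : ℝ}
    (hC : ∀ᵐ ξ, ‖m ξ‖ ≤ C * ‖ξ‖ ^ (-α)) (φ : Mollifier d) {μ : Measure (E d)} [IsFiniteMeasure μ]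
    {p q : ℝ≥0∞} (hp : 1 ≤ p) (hq : 1 ≤ q) {D K : ℝ≥0} {w : (E d → ℂ) → E d → ℝ≥0∞}
    (hwm : ∀ f, MemLp f p μ → AEMeasurable (w f) volume)
    (hwK : ∀ f, MemLp f p μ → ∫⁻ ξ, w f ξ ≤ K * eLpNorm f p μ ^ 2)
    (hD : ∀ f, MemLp f p μ → ∀ u : E d → ℂ, Continuous u → Integrable (fun ξ ↦ m ξ * u ξ) →
      eLpNorm (multiplierConv (fun ξ ↦ m ξ * u ξ) μ f) q μ ≤
        D * (∫⁻ ξ, ‖u ξ‖ₑ ^ 2 * w f ξ) ^ (1 / 2 : ℝ)) :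
    ConvBounded Λ φ μ p q := by
  refine ⟨D * NNReal.sqrt K, fun f hf ↦ ?_⟩
  have : Fact (1 ≤ q) := ⟨hq⟩
  have hfint : Integrable f μ := hf.integrable hp
  have hwi : ∫⁻ ξ, w f ξ ≠ ⊤ :=
    ((hwK f hf).trans_lt (ENNReal.mul_lt_top ENNReal.coe_lt_top (ENNReal.pow_lt_top hf.2))).ne
  have hint : ∀ {ε : ℝ}, 0 < ε → Integrable fun ξ ↦ m ξ * φ.hat (ε • ξ) :=
    fun hε ↦ integrable_mul_hat hm hC φ hε
  have hhc : ∀ ε : ℝ, Continuous fun ξ : E d ↦ φ.hat (ε • ξ) := fun ε ↦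
    φ.continuous_hat.comp (by fun_prop)
  set F : ℝ → E d → ℂ := fun ε ↦ multiplierConv (fun ξ ↦ m ξ * φ.hat (ε • ξ)) μ f with hF
  set η : ℝ → ℝ≥0∞ := fun ε ↦ ∫⁻ ξ, ‖φ.hat (ε • ξ) - 1‖ₑ ^ 2 * w f ξ with hη
  have hη0 : Tendsto η (𝓝[>] 0) (𝓝 0) := tendsto_lintegral_sq_hat_sub_one φ (hwm f hf) hwi
  have hFL : ∀ {ε : ℝ}, 0 < ε → MemLp (F ε) q μ := fun hε ↦ memLp_multiplierConv (hint hε) hfint q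
  -- The difference of two regularisations is again a multiplier, with u the difference of the two
  -- symbols; comparing each symbol with 1 makes it small.
  have hpair : ∀ {ε δ : ℝ}, 0 < ε → 0 < δ →
      eLpNorm (F ε - F δ) q μ ≤ D * (2 * (η ε + η δ)) ^ (1 / 2 : ℝ) := by
    intro ε δ hε hδ
    have e1 : F ε - F δ = multiplierConv
        (fun ξ ↦ m ξ * (φ.hat (ε • ξ) - φ.hat (δ • ξ))) μ f := by
      ext x
      simp only [mul_sub]
      exact (multiplierConv_sub (hint hε) (hint hδ) hfint x).symm
    rw [e1]
    refine (hD f hf _ ((hhc ε).sub (hhc δ)) ?_).trans ?_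
    · exact ((hint hε).sub (hint hδ)).congr (ae_of_all _ fun ξ ↦ by simp [mul_sub])
    · gcongr
      have hm1 : AEMeasurable (fun ξ ↦ ‖φ.hat (ε • ξ) - 1‖ₑ ^ 2 * w f ξ) volume :=
        ((((hhc ε).sub continuous_const).measurable.enorm.pow_const 2).aemeasurable).mul (hwm f hf)
      rw [hη, ← lintegral_add_left' hm1, ← lintegral_const_mul' _ _ (by norm_num)]
      refine lintegral_mono fun ξ ↦ ?_
      beta_reduce
      rw [← add_mul, ← mul_assoc]
      gcongr
      exact enorm_sub_sq_le _ _ _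
  have hsqrt : ∀ {ι : Type} {l : Filter ι} {a : ι → ℝ≥0∞}, Tendsto a l (𝓝 0) →
      Tendsto (fun i ↦ (D : ℝ≥0∞) * (2 * a i) ^ (1 / 2 : ℝ)) l (𝓝 0) := by
    intro ι l a ha
    have h1 := ENNReal.Tendsto.const_mul (a := 2) ha (Or.inr (by norm_num))
    have h2 := (ENNReal.continuous_rpow_const (y := (1 / 2 : ℝ))).tendsto (2 * 0) |>.comp h1
    have h3 := ENNReal.Tendsto.const_mul (a := (D : ℝ≥0∞)) h2 (Or.inr ENNReal.coe_ne_top)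
    simpa using h3
  -- Completeness of L^q is used along the sequence ε = 1/(n+1); the pairwise bound then extends the
  -- convergence to all ε → 0+.
  set e : ℕ → ℝ := fun n ↦ 1 / ((n : ℝ) + 1) with he
  have he0 : ∀ n, 0 < e n := fun n ↦ by positivity
  have het : Tendsto e atTop (𝓝[>] 0) :=
    tendsto_nhdsWithin_iff.mpr ⟨tendsto_one_div_add_atTop_nhds_zero_nat,
      Eventually.of_forall he0⟩
  have hηe : Tendsto (fun n ↦ η (e n)) atTop (𝓝 0) := hη0.comp het
  set G : ℕ → Lp ℂ q μ := fun n ↦ (hFL (he0 n)).toLp (F (e n)) with hG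
  have hcauchy : CauchySeq G := by
    rw [EMetric.cauchySeq_iff]
    intro r hr
    have h1 : Tendsto (fun z : ℕ × ℕ ↦ η (e z.1) + η (e z.2)) atTop (𝓝 0) := by
      rw [← prod_atTop_atTop_eq]
      simpa using (hηe.comp tendsto_fst).add (hηe.comp tendsto_snd)
    have h2 := (hsqrt h1).eventually (gt_mem_nhds hr)
    rw [eventually_atTop] at h2
    obtain ⟨⟨N₁, N₂⟩, hN⟩ := h2
    refine ⟨max N₁ N₂, fun n hn k hk ↦ ?_⟩
    rw [hG, Lp.edist_toLp_toLp]
    exact (hpair (he0 n) (he0 k)).trans_lt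
      (hN (n, k) ⟨(le_max_left _ _).trans hn, (le_max_right _ _).trans hk⟩)
  obtain ⟨h, hhL, hh⟩ : ∃ (h : E d → ℂ) (hhL : MemLp h q μ), Tendsto G atTop (𝓝 (hhL.toLp h)) := by
    obtain ⟨h, hh⟩ := cauchySeq_tendsto_of_complete hcauchy
    exact ⟨h, Lp.memLp h, by rwa [Lp.toLp_coeFn]⟩
  have hlimn : Tendsto (fun n ↦ eLpNorm (F (e n) - h) q μ) atTop (𝓝 0) := by
    have := (Lp.tendsto_Lp_iff_tendsto_eLpNorm'' (fun n ↦ F (e n)) (fun n ↦ hFL (he0 n)) h hhL).mp hh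
    exact this
  have hclose : ∀ {ε : ℝ}, 0 < ε → eLpNorm (F ε - h) q μ ≤ D * (2 * η ε) ^ (1 / 2 : ℝ) := by
    intro ε hε
    have hlim : Tendsto (fun n ↦ (D : ℝ≥0∞) * (2 * (η ε + η (e n))) ^ (1 / 2 : ℝ) +
        eLpNorm (F (e n) - h) q μ) atTop (𝓝 (D * (2 * η ε) ^ (1 / 2 : ℝ))) := by
      have h1 := (tendsto_const_nhds (x := η ε)).add hηe
      have h2 := ENNReal.Tendsto.const_mul (a := 2) h1 (Or.inr (by norm_num))
      have h3 := (ENNReal.continuous_rpow_const (y := (1 / 2 : ℝ))).tendsto (2 * (η ε + 0))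
        |>.comp h2
      have h4 := (ENNReal.Tendsto.const_mul (a := (D : ℝ≥0∞)) h3 (Or.inr ENNReal.coe_ne_top)).add
        hlimn
      simpa using h4
    refine ge_of_tendsto' hlim fun n ↦ ?_
    calc eLpNorm (F ε - h) q μ = eLpNorm ((F ε - F (e n)) + (F (e n) - h)) q μ := by
          rw [sub_add_sub_cancel]
      _ ≤ eLpNorm (F ε - F (e n)) q μ + eLpNorm (F (e n) - h) q μ :=
          eLpNorm_add_le ((hFL hε).sub (hFL (he0 n))).aestronglyMeasurable
            ((hFL (he0 n)).sub hhL).aestronglyMeasurable hq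
      _ ≤ _ := by gcongr; exact hpair hε (he0 n)
  have htend : Tendsto (fun ε ↦ eLpNorm (F ε - h) q μ) (𝓝[>] 0) (𝓝 0) :=
    tendsto_of_tendsto_of_tendsto_of_le_of_le' tendsto_const_nhds (hsqrt hη0)
      (Eventually.of_forall fun _ ↦ zero_le)
      (eventually_nhdsWithin_of_forall fun ε hε ↦ hclose hε)
  refine ⟨h, ⟨hhL, ?_⟩, ?_⟩
  · refine htend.congr' (eventually_nhdsWithin_of_forall fun ε hε ↦ ?_)
    congr 1
    ext x
    rw [Pi.sub_apply, regConv_eq_multiplierConv hΛ φ hε (hint hε) hfint]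
  -- The bound is uniform in ε because the mollifier symbol has modulus at most 1, so it survives in
  -- the limit.
  · have hFbound : ∀ {ε : ℝ}, 0 < ε → eLpNorm (F ε) q μ ≤
        ((D * NNReal.sqrt K : ℝ≥0) : ℝ≥0∞) * eLpNorm f p μ := by
      intro ε hε
      refine (hD f hf _ (hhc ε) (hint hε)).trans ?_
      have h1 : ∫⁻ ξ, ‖φ.hat (ε • ξ)‖ₑ ^ 2 * w f ξ ≤ K * eLpNorm f p μ ^ 2 := by
        refine le_trans (lintegral_mono fun ξ ↦ ?_) (hwK f hf)
        refine mul_le_of_le_one_left zero_le (pow_le_one₀ zero_le ?_)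
        rw [← ofReal_norm, ENNReal.ofReal_le_one]
        exact φ.norm_hat_le _
      calc _ ≤ (D : ℝ≥0∞) * (K * eLpNorm f p μ ^ 2) ^ (1 / 2 : ℝ) := by gcongr
        _ = _ := by
          rw [ENNReal.mul_rpow_of_nonneg _ _ (by norm_num), ← ENNReal.rpow_natCast,
            ← ENNReal.rpow_mul, ENNReal.coe_mul, mul_assoc, NNReal.sqrt_eq_rpow,
            ENNReal.coe_rpow_of_nonneg _ (by norm_num)]
          norm_num
    have hlim : Tendsto (fun ε ↦ eLpNorm (F ε - h) q μ +
        ((D * NNReal.sqrt K : ℝ≥0) : ℝ≥0∞) * eLpNorm f p μ) (𝓝[>] 0)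
        (𝓝 (0 + ((D * NNReal.sqrt K : ℝ≥0) : ℝ≥0∞) * eLpNorm f p μ)) :=
      htend.add tendsto_const_nhds
    rw [zero_add] at hlim
    refine ge_of_tendsto hlim (eventually_nhdsWithin_of_forall fun ε hε ↦ ?_)
    have hε' : 0 < ε := hε
    calc eLpNorm h q μ = eLpNorm (F ε - (F ε - h)) q μ := by rw [sub_sub_cancel]
      _ ≤ eLpNorm (F ε) q μ + eLpNorm (F ε - h) q μ :=
          eLpNorm_sub_le (hFL hε').aestronglyMeasurable
            ((hFL hε').sub hhL).aestronglyMeasurable hq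
      _ ≤ _ := by rw [add_comm]; gcongr; exact hFbound hε'

/-! ### Boundedness below the thresholds -/

theorem convBounded_of_lt {Λ : 𝓢'(E d, ℂ)} {α s : ℝ} (hΛ : FourierDecay Λ α)
    {μ : Measure (E d)} (hK : CompactlySupported μ) (hB : BallCondition μ s) (hs : 0 < s)
    (φ : Mollifier d) {p q q' : ℝ} (hp1 : 1 ≤ p) (hp2 : p ≤ 2) (hq : q.HolderConjugate q')
    (hq2 : q' ≤ 2) (hα : (d : ℝ) - s * (1 - 1 / p) - s / q < α) :
    ConvBounded Λ φ μ (ENNReal.ofReal p) (ENNReal.ofReal q) := by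
  obtain ⟨m, hm, hΛm, C, hC⟩ := hΛ
  obtain ⟨hfin, A, hA, hball⟩ := exists_ball_bound hK hB hs
  -- The slack in the hypothesis on α is shared equally, so that β₁ and β₂ each exceed their
  -- restriction threshold by δ/2 and still sum to α.
  set δ : ℝ := α - ((d : ℝ) - s * (1 - 1 / p) - s / q) with hδ
  set β₁ : ℝ := (d : ℝ) / 2 - s * (1 - 1 / p) + δ / 2 with hβ₁
  set β₂ : ℝ := (d : ℝ) / 2 - s / q + δ / 2 with hβ₂
  have hβ : β₁ + β₂ = α := by rw [hβ₁, hβ₂, hδ]; ring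
  have hqq : 1 - 1 / q' = 1 / q := by
    have := hq.inv_add_inv_eq_one
    rw [one_div, one_div]; linarith
  obtain ⟨K₁, hK₁⟩ := exists_lintegral_sq_fourierOf_mul_weight_le hm hA hball hp1 hp2
    (β := β₁) (by rw [hβ₁, hδ]; linarith)
  obtain ⟨K₂, hK₂⟩ := exists_lintegral_sq_fourierOf_mul_weight_le hm hA hball
    hq.symm.lt.le hq2 (β := β₂) (by
      rw [hqq, hβ₂, hδ, mul_one_div]; linarith)
  have hp1' : 1 ≤ ENNReal.ofReal p := by rwa [ENNReal.one_le_ofReal]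
  have hq1' : 1 ≤ ENNReal.ofReal q' := by rw [ENNReal.one_le_ofReal]; exact hq.symm.lt.le
  refine convBounded_of_multiplier_estimate (w := fun f ξ ↦ ‖fourierOf μ f ξ‖ₑ ^ 2 * weight m β₁ ξ)
    (D := (max C 1).toNNReal * NNReal.sqrt K₂) (K := K₁) hΛm hm hC φ hp1'
    (by rw [ENNReal.one_le_ofReal]; exact hq.lt.le) ?_ hK₁ ?_
  · intro f hf
    exact (((continuous_fourierOf (hf.integrable hp1')).measurable.enorm.pow_const 2).aemeasurable).mul
      (aemeasurable_weight hm.aestronglyMeasurable β₁)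
  · intro f hf u hu hmu
    have hfint := hf.integrable hp1'
    refine eLpNorm_le_of_forall_enorm_integral_le
      (continuous_multiplierConv hmu hfint).aestronglyMeasurable
      (norm_multiplierConv_le _ μ f) hq fun g hg ↦ ?_
    have hgint := hg.integrable hq1'
    rw [integral_multiplierConv_mul_conj hmu hfint hgint]
    calc _ ≤ ∫⁻ ξ, ‖m ξ‖ₑ * ‖u ξ‖ₑ * ‖fourierOf μ f ξ‖ₑ * ‖fourierOf μ g ξ‖ₑ := by
          refine (enorm_integral_le_lintegral_enorm _).trans (lintegral_mono fun ξ ↦ ?_)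
          rw [enorm_mul, enorm_mul, enorm_mul, RCLike.enorm_conj]
      _ ≤ _ := lintegral_enorm_mul_le_weight hm.aestronglyMeasurable hβ hC hu.measurable.enorm
          (continuous_fourierOf hfint).measurable.enorm
          (continuous_fourierOf hgint).measurable.enorm
      _ ≤ ENNReal.ofReal (max C 1) *
          ((∫⁻ ξ, ‖u ξ‖ₑ ^ 2 * (‖fourierOf μ f ξ‖ₑ ^ 2 * weight m β₁ ξ)) ^ (1 / 2 : ℝ) *
            (K₂ * eLpNorm g (ENNReal.ofReal q') μ ^ 2) ^ (1 / 2 : ℝ)) := by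
          gcongr
          exact hK₂ g hg
      _ = _ := by
          rw [ENNReal.mul_rpow_of_nonneg (K₂ : ℝ≥0∞) _ (by norm_num), ← ENNReal.rpow_natCast
            (eLpNorm g _ μ), ← ENNReal.rpow_mul (eLpNorm g _ μ), ENNReal.coe_mul,
            NNReal.sqrt_eq_rpow, ENNReal.coe_rpow_of_nonneg _ (by norm_num), ENNReal.ofReal]
          norm_num
          ring

theorem lintegral_weight_ne_top {m : E d → ℂ} (hm : LocallyIntegrable m) {β : ℝ}
    (hβ : (d : ℝ) < 2 * β) : ∫⁻ ξ, weight m β ξ ≠ ⊤ := by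
  have h := lintegral_mul_weight m β (fun _ ↦ 1)
  simp only [one_mul] at h
  rw [h]
  refine ENNReal.add_ne_top.mpr ⟨(lintegral_enorm_lowFrequency_lt_top hm).ne, ?_⟩
  have hfin := finite_integral_one_add_norm (E := E d) (μ := volume) (r := 2 * β)
    (by rwa [finrank_euclideanSpace_fin])
  have hβ0 : 0 ≤ 2 * β := by linarith [(Nat.cast_nonneg d : (0 : ℝ) ≤ d)]
  have hle : ∀ ξ ∈ {ξ : E d | 1 ≤ ‖ξ‖}, ENNReal.ofReal (‖ξ‖ ^ (-(2 * β))) ≤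
      ENNReal.ofReal (2 ^ (2 * β)) * ENNReal.ofReal ((1 + ‖ξ‖) ^ (-(2 * β))) := by
    intro ξ hξ
    have hξ1 : 1 ≤ ‖ξ‖ := hξ
    rw [← ENNReal.ofReal_mul (by positivity)]
    refine ENNReal.ofReal_le_ofReal ?_
    rw [Real.rpow_neg (by positivity), Real.rpow_neg (by positivity), ← div_eq_mul_inv,
      ← Real.div_rpow (by norm_num) (by positivity), ← Real.inv_rpow (by positivity)]
    refine Real.rpow_le_rpow (by positivity) ?_ hβ0
    rw [inv_eq_one_div, div_le_div_iff₀ (by positivity) (by positivity)]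
    linarith
  refine ne_of_lt ((setLIntegral_mono' measurableSet_one_le_norm hle).trans_lt ?_)
  refine (setLIntegral_le_lintegral _ _).trans_lt ?_
  rw [lintegral_const_mul' _ _ ENNReal.ofReal_ne_top]
  exact ENNReal.mul_lt_top ENNReal.ofReal_lt_top hfin

/-- The endpoint p = 1, where the duality argument for finite q is unavailable. Taking absolute
values in the inversion integral amounts to G = 1 in the Cauchy–Schwarz bound, and α > d makes the
weight with β = α/2 integrable. -/
theorem convBounded_one_top {Λ : 𝓢'(E d, ℂ)} {α s : ℝ} (hΛ : FourierDecay Λ α)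
    {μ : Measure (E d)} (hK : CompactlySupported μ) (hB : BallCondition μ s) (hs : 0 < s)
    (φ : Mollifier d) (hα : (d : ℝ) < α) : ConvBounded Λ φ μ 1 ⊤ := by
  obtain ⟨m, hm, hΛm, C, hC⟩ := hΛ
  obtain ⟨hfin, A, hA, hball⟩ := exists_ball_bound hK hB hs
  obtain ⟨K₁, hK₁⟩ := exists_lintegral_sq_fourierOf_mul_weight_le hm hA hball
    (p := 1) le_rfl one_le_two (β := α / 2) (by norm_num; linarith)
  rw [ENNReal.ofReal_one] at hK₁
  have hW := lintegral_weight_ne_top hm (β := α / 2) (by linarith)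
  refine convBounded_of_multiplier_estimate
    (w := fun f ξ ↦ ‖fourierOf μ f ξ‖ₑ ^ 2 * weight m (α / 2) ξ)
    (D := (max C 1).toNNReal * NNReal.sqrt (∫⁻ ξ, weight m (α / 2) ξ).toNNReal) (K := K₁)
    hΛm hm hC φ le_rfl le_top ?_ hK₁ ?_
  · intro f hf
    exact (((continuous_fourierOf (hf.integrable le_rfl)).measurable.enorm.pow_const 2).aemeasurable).mul
      (aemeasurable_weight hm.aestronglyMeasurable _)
  · intro f hf u hu hmu
    have hfint := hf.integrable le_rfl
    rw [eLpNorm_exponent_top]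
    refine essSup_le_of_ae_le _ (ae_of_all _ fun x ↦ ?_)
    calc ‖multiplierConv (fun ξ ↦ m ξ * u ξ) μ f x‖ₑ
        ≤ ∫⁻ ξ, ‖m ξ‖ₑ * ‖u ξ‖ₑ * ‖fourierOf μ f ξ‖ₑ * 1 := by
          rw [multiplierConv, fourierOf, VectorFourier.fourierIntegral]
          refine (enorm_integral_le_lintegral_enorm _).trans (lintegral_mono fun ξ ↦ ?_)
          rw [← ofReal_norm, Circle.norm_smul, ofReal_norm, enorm_mul, enorm_mul, mul_one]
      _ ≤ _ := lintegral_enorm_mul_le_weight hm.aestronglyMeasurable (add_halves α) hC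
          hu.measurable.enorm (continuous_fourierOf hfint).measurable.enorm measurable_const
      _ = _ := by
          rw [ENNReal.coe_mul, NNReal.sqrt_eq_rpow, ENNReal.coe_rpow_of_nonneg _ (by norm_num),
            ENNReal.ofReal, ENNReal.coe_toNNReal hW]
          simp only [one_pow, one_mul]
          ring

theorem convBounded_lp_two {Λ : 𝓢'(E d, ℂ)} {α s : ℝ} (hΛ : FourierDecay Λ α)
    {μ : Measure (E d)} (hK : CompactlySupported μ) (hB : BallCondition μ s) (hs : 0 < s)
    (φ : Mollifier d) {p : ℝ} (hp1 : 1 ≤ p) (hp2 : p ≤ 2)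
    (hp : 1 / p < (3 * s + 2 * α - 2 * d) / (2 * s)) :
    ConvBounded Λ φ μ (ENNReal.ofReal p) 2 := by
  have h := convBounded_of_lt hΛ hK hB hs φ hp1 hp2 Real.HolderConjugate.two_two le_rfl (by
    rw [lt_div_iff₀ (by positivity)] at hp
    nlinarith)
  simpa using h

theorem convBounded_lp_conjExponent {Λ : 𝓢'(E d, ℂ)} {α s : ℝ} (hΛ : FourierDecay Λ α)
    {μ : Measure (E d)} (hK : CompactlySupported μ) (hB : BallCondition μ s) (hs : 0 < s)
    (φ : Mollifier d) {p : ℝ} (hp1 : 1 ≤ p) (hp2 : p ≤ 2)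
    (hp : 1 / p < (2 * s + α - d) / (2 * s)) :
    ConvBounded Λ φ μ (ENNReal.ofReal p) (ENNReal.conjExponent (ENNReal.ofReal p)) := by
  rw [lt_div_iff₀ (by positivity)] at hp
  rcases hp1.eq_or_lt with rfl | hp1'
  · have : ENNReal.conjExponent (ENNReal.ofReal 1) = ⊤ := by simp [ENNReal.conjExponent]
    rw [this, ENNReal.ofReal_one]
    exact convBounded_one_top hΛ hK hB hs φ (by linarith)
  · have hpq : p.HolderConjugate p.conjExponent := Real.HolderConjugate.conjExponent hp1'
    have hconj : ENNReal.conjExponent (ENNReal.ofReal p) = ENNReal.ofReal p.conjExponent := by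
      rw [ENNReal.conjExponent, ← ENNReal.ofReal_one, ← ENNReal.ofReal_sub _ zero_le_one,
        ← ENNReal.ofReal_inv_of_pos (by linarith),
        ← ENNReal.ofReal_add zero_le_one (inv_nonneg.mpr (by linarith)), Real.conjExponent]
      congr 1
      have : p - 1 ≠ 0 := by linarith
      field_simp
      ring
    rw [hconj]
    refine convBounded_of_lt hΛ hK hB hs φ hp1 hp2 hpq.symm hp2 ?_
    have h1 : s / p.conjExponent = s * (1 - 1 / p) := by
      have := hpq.inv_add_inv_eq_one
      rw [div_eq_mul_inv]
      congr 1
      rw [one_div]; linarith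
    rw [h1]
    nlinarith

/-! ### The Riesz kernel and its Fourier transform -/

theorem locallyIntegrable_norm_rpow_neg (hd : 1 ≤ d) {a : ℝ} (ha : a < d) :
    LocallyIntegrable fun x : E d ↦ ‖x‖ ^ (-a) :=
  locallyIntegrable_of_norm_le_rpow (C := 1) (α := a)
    (by rwa [finrank_euclideanSpace_fin]) (by rwa [finrank_euclideanSpace_fin])
    (ae_of_all _ fun x ↦ by
      rw [one_mul, Real.norm_eq_abs, abs_of_nonneg (Real.rpow_nonneg (norm_nonneg x) _)])
    (Measurable.aestronglyMeasurable (by fun_prop))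

theorem integrable_norm_rpow_neg_mul (hd : 1 ≤ d) {a : ℝ} (ha : a < d) (v : 𝓢(E d, ℂ)) :
    Integrable fun x : E d ↦ ((‖x‖ ^ (-a) : ℝ) : ℂ) * v x := by
  refine integrable_mul_schwartz (C := 1) (α := a) ?_ (ae_of_all _ fun x ↦ ?_) v
  · intro x
    obtain ⟨u, hu, h⟩ := locallyIntegrable_norm_rpow_neg hd ha x
    exact ⟨u, hu, h.ofReal⟩
  · rw [one_mul, Complex.norm_real, Real.norm_eq_abs, abs_of_nonneg (by positivity)]

/-- The measure `|x|^{-a} dx`. -/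
def powerMeasure (d : ℕ) (a : ℝ) : Measure (E d) :=
  volume.withDensity fun x ↦ ENNReal.ofReal (‖x‖ ^ (-a))

theorem powerMeasure_hasTemperateGrowth (hd : 1 ≤ d) {a : ℝ} (ha0 : 0 < a) (ha : a < d) :
    (powerMeasure d a).HasTemperateGrowth := by
  refine ⟨d + 1, ?_⟩
  rw [powerMeasure, integrable_withDensity_iff_integrable_smul' (by fun_prop)
    (ae_of_all _ fun _ ↦ ENNReal.ofReal_lt_top)]
  have hmeas : Measurable fun x : E d ↦ (ENNReal.ofReal (‖x‖ ^ (-a))).toReal •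
      (1 + ‖x‖) ^ (-((d + 1 : ℕ) : ℝ)) := by fun_prop
  have hnorm : ∀ x : E d, ‖(ENNReal.ofReal (‖x‖ ^ (-a))).toReal •
      (1 + ‖x‖) ^ (-((d + 1 : ℕ) : ℝ))‖ = ‖x‖ ^ (-a) * (1 + ‖x‖) ^ (-((d + 1 : ℕ) : ℝ)) := fun x ↦ by
    rw [ENNReal.toReal_ofReal (by positivity), smul_eq_mul, Real.norm_eq_abs,
      abs_of_nonneg (by positivity)]
  rw [← integrableOn_univ, ← Set.union_compl_self (Metric.closedBall (0 : E d) 1)]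
  refine IntegrableOn.union ?_ ?_
  · refine Integrable.mono' ((locallyIntegrable_norm_rpow_neg hd ha).integrableOn_isCompact
      (isCompact_closedBall 0 1)) hmeas.aestronglyMeasurable (ae_of_all _ fun x ↦ ?_)
    rw [hnorm]
    refine mul_le_of_le_one_right (by positivity) ?_
    exact Real.rpow_le_one_of_one_le_of_nonpos (by linarith [norm_nonneg x])
      (neg_nonpos.mpr (Nat.cast_nonneg _))
  · have h := integrable_one_add_norm (E := E d) (μ := volume) (r := ((d + 1 : ℕ) : ℝ))
      (by rw [finrank_euclideanSpace_fin]; push_cast; linarith)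
    refine Integrable.mono' h.integrableOn hmeas.aestronglyMeasurable ?_
    filter_upwards [ae_restrict_mem Metric.isClosed_closedBall.measurableSet.compl] with x hx
    have hx1 : 1 ≤ ‖x‖ := by
      simp only [Set.mem_compl_iff, Metric.mem_closedBall, dist_zero_right, not_le] at hx
      exact hx.le
    rw [hnorm]
    refine mul_le_of_le_one_left (by positivity) ?_
    exact Real.rpow_le_one_of_one_le_of_nonpos hx1 (by linarith)

theorem exists_isRieszKernel (hd : 1 ≤ d) {α : ℝ} (hα0 : 0 < α) (hα : α < d) :
    ∃ Λ : 𝓢'(E d, ℂ), IsRieszKernel Λ α := by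
  have := powerMeasure_hasTemperateGrowth hd (a := (d : ℝ) - α) (by linarith) (by linarith)
  refine ⟨(powerMeasure d ((d : ℝ) - α)).toTemperedDistribution, fun ψ ↦ ?_⟩
  refine Eq.trans (b := ∫ x, ψ x ∂powerMeasure d ((d : ℝ) - α)) rfl ?_
  rw [powerMeasure, integral_withDensity_eq_integral_toReal_smul (by fun_prop)
      (ae_of_all _ fun _ ↦ ENNReal.ofReal_lt_top)]
  refine integral_congr_ae (ae_of_all _ fun x ↦ ?_)
  beta_reduce
  rw [ENNReal.toReal_ofReal (by positivity), Complex.real_smul]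

/-- The constant in the representation of a power as a superposition of Gaussians. -/
def gaussianConst (b : ℝ) : ℝ := (1 / Real.pi) ^ (b / 2) * Real.Gamma (b / 2)

theorem gaussianConst_pos {b : ℝ} (hb : 0 < b) : 0 < gaussianConst b :=
  mul_pos (by positivity) (Real.Gamma_pos_of_pos (by positivity))

theorem integral_rpow_mul_gaussian {b : ℝ} (hb : 0 < b) {x : E d} (hx : x ≠ 0) :
    ∫ t in Set.Ioi (0 : ℝ), t ^ (b / 2 - 1) * Real.exp (-(Real.pi * t) * ‖x‖ ^ 2) =
      gaussianConst b * ‖x‖ ^ (-b) := by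
  have hx0 : 0 < ‖x‖ := norm_pos_iff.mpr hx
  have h := Real.integral_rpow_mul_exp_neg_mul_Ioi (a := b / 2) (r := Real.pi * ‖x‖ ^ 2)
    (by positivity) (by positivity)
  have e : (1 / (Real.pi * ‖x‖ ^ 2)) ^ (b / 2) = (1 / Real.pi) ^ (b / 2) * ‖x‖ ^ (-b) := by
    have e0 : 1 / (Real.pi * ‖x‖ ^ 2) = 1 / Real.pi * (‖x‖ ^ 2)⁻¹ := by field_simp
    rw [e0, Real.mul_rpow (by positivity) (by positivity),
      Real.inv_rpow (by positivity), ← Real.rpow_natCast, ← Real.rpow_mul hx0.le,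
      Real.rpow_neg hx0.le]
    congr 3
    push_cast; ring
  rw [e] at h
  rw [gaussianConst]
  calc _ = ∫ t in Set.Ioi (0 : ℝ), t ^ (b / 2 - 1) * Real.exp (-(Real.pi * ‖x‖ ^ 2 * t)) := by
        congr 1; ext t; ring_nf
    _ = _ := by rw [h]; ring

/-- The substitution t ↦ 1/t in the previous formula; this is the form in which Gaussians appear
after Fourier transformation. -/
theorem integral_rpow_mul_gaussian_inv {b : ℝ} (hb : 0 < b) {x : E d} (hx : x ≠ 0) :
    ∫ t in Set.Ioi (0 : ℝ), t ^ (-(b / 2) - 1) * Real.exp (-Real.pi * ‖x‖ ^ 2 / t) =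
      gaussianConst b * ‖x‖ ^ (-b) := by
  rw [← integral_rpow_mul_gaussian hb hx, ← integral_comp_rpow_Ioi _ (neg_ne_zero.mpr one_ne_zero)]
  refine setIntegral_congr_fun measurableSet_Ioi fun t ht ↦ ?_
  have ht0 : 0 < t := ht
  simp only [smul_eq_mul, abs_neg, abs_one, one_mul]
  rw [← Real.rpow_mul ht0.le, ← mul_assoc, ← Real.rpow_add ht0, Real.rpow_neg_one]
  congr 2
  · ring
  · rw [div_inv_eq_mul]; ring

/-- Fubini for a function given as a superposition. -/
theorem integral_mul_eq_integral_integral {k : ℝ → E d → ℝ} {L : E d → ℝ}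
    (hk : Measurable (Function.uncurry k)) (hk0 : ∀ t, 0 < t → ∀ x, 0 ≤ k t x)
    (hL : ∀ᵐ x, ∫ t in Set.Ioi (0 : ℝ), k t x = L x) (hL0 : ∀ᵐ x, L x ≠ 0) {v : E d → ℂ}
    (hv : AEStronglyMeasurable v volume) (hLv : Integrable fun x ↦ ((L x : ℝ) : ℂ) * v x) :
    ∫ x, ((L x : ℝ) : ℂ) * v x = ∫ t in Set.Ioi (0 : ℝ), ∫ x, ((k t x : ℝ) : ℂ) * v x := by
  -- A non-integrable function has integral 0 by convention, so the nonzero value L x forces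
  -- integrability.
  have hint : ∀ᵐ x, IntegrableOn (fun t ↦ k t x) (Set.Ioi 0) := by
    filter_upwards [hL, hL0] with x hx hx0
    by_contra h
    rw [integral_undef h] at hx
    exact hx0 hx.symm
  have hk' : Measurable fun z : E d × ℝ ↦ k z.2 z.1 := hk.comp measurable_swap
  have hm : AEStronglyMeasurable (Function.uncurry fun (x : E d) (t : ℝ) ↦ ((k t x : ℝ) : ℂ) * v x)
      (volume.prod (volume.restrict (Set.Ioi (0 : ℝ)))) := by
    refine AEStronglyMeasurable.mul ?_ hv.comp_fst
    exact (Complex.measurable_ofReal.comp hk').aestronglyMeasurable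
  have hprod : Integrable (Function.uncurry fun (x : E d) (t : ℝ) ↦ ((k t x : ℝ) : ℂ) * v x)
      (volume.prod (volume.restrict (Set.Ioi (0 : ℝ)))) := by
    rw [integrable_prod_iff hm]
    constructor
    · filter_upwards [hint] with x hx
      have : IntegrableOn (fun t ↦ ((k t x : ℝ) : ℂ)) (Set.Ioi 0) := hx.ofReal
      exact this.mul_const (v x)
    · refine hLv.norm.congr ?_
      filter_upwards [hL] with x hx
      have hLn : 0 ≤ L x := by
        rw [← hx]
        exact setIntegral_nonneg measurableSet_Ioi fun t ht ↦ hk0 t ht x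
      simp only [Function.uncurry_apply_pair, norm_mul, Complex.norm_real, Real.norm_eq_abs]
      rw [integral_mul_const, abs_of_nonneg hLn, ← hx]
      congr 1
      exact setIntegral_congr_fun measurableSet_Ioi fun t ht ↦ (abs_of_nonneg (hk0 t ht x)).symm
  rw [← integral_integral_swap hprod]
  refine integral_congr_ae ?_
  filter_upwards [hL] with x hx
  rw [integral_mul_const, integral_complex_ofReal, hx]

theorem integral_gaussian_mul_fourier {t : ℝ} (ht : 0 < t) (ψ : 𝓢(E d, ℂ)) :
    ∫ x, ((Real.exp (-(Real.pi * t) * ‖x‖ ^ 2) : ℝ) : ℂ) * (𝓕 ψ) x =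
      ∫ ξ, ((t ^ (-((d : ℝ) / 2)) * Real.exp (-Real.pi * ‖ξ‖ ^ 2 / t) : ℝ) : ℂ) * ψ ξ := by
  have hg : Integrable fun x : E d ↦ ((Real.exp (-(Real.pi * t) * ‖x‖ ^ 2) : ℝ) : ℂ) :=
    (integrable_exp_neg_norm_sq (by positivity)).ofReal
  have h := VectorFourier.integral_fourierIntegral_smul_eq_flip (μ := volume) (ν := volume)
    (L := innerₗ (E d)) (f := ψ) Real.continuous_fourierChar continuous_innerₗ_uncurry
    ψ.integrable hg
  simp only [smul_eq_mul, flip_innerₗ] at h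
  calc _ = _ := by
        refine Eq.trans (integral_congr_ae (ae_of_all _ fun x ↦ ?_)) h
        beta_reduce
        rw [mul_comm]
        rfl
    _ = _ := by
        refine integral_congr_ae (ae_of_all _ fun ξ ↦ ?_)
        beta_reduce
        rw [mul_comm]
        congr 1
        have := fourier_modulated_gaussian ht 0 ξ
        simp only [inner_zero_left, AddChar.map_zero_eq_one, one_smul, zero_sub, norm_neg] at this
        exact this

/-- Write |x|^(-(d-α)) as a superposition of Gaussians exp(-πt|x|²), transform each against ψ, and
recognise the result as the superposition for |ξ|^(-α). Fubini is applied once on each side, and c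
is the quotient of the two Gamma constants. -/
theorem fourierDecay_of_isRieszKernel (hd : 1 ≤ d) {α : ℝ} (hα0 : 0 < α) (hα : α < d)
    {Λ : 𝓢'(E d, ℂ)} (hΛ : IsRieszKernel Λ α) : FourierDecay Λ α := by
  have hnt : Nontrivial (E d) := Module.nontrivial_of_finrank_pos (R := ℝ)
    (by rw [finrank_euclideanSpace_fin]; omega)
  have hne : ∀ᵐ x : E d, x ≠ 0 := by
    rw [ae_iff]; simp
  set a : ℝ := (d : ℝ) - α with ha
  have ha0 : 0 < a := by rw [ha]; linarith
  have had : a < d := by rw [ha]; linarith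
  have hca := gaussianConst_pos ha0
  have hcα := gaussianConst_pos hα0
  set c : ℝ := gaussianConst α / gaussianConst a with hc
  refine ⟨fun ξ ↦ ((c * ‖ξ‖ ^ (-α) : ℝ) : ℂ), ?_, fun ψ ↦ ?_, c, ae_of_all _ fun ξ ↦ ?_⟩
  · intro x
    obtain ⟨u, hu, h⟩ := locallyIntegrable_norm_rpow_neg hd hα x
    exact ⟨u, hu, (h.const_mul c).ofReal⟩
  · set χ : 𝓢(E d, ℂ) := 𝓕 ψ with hχ
    have hrw : ∀ (b e : ℝ) (v : E d → ℂ) (x : E d),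
        ((e * ‖x‖ ^ (-b) : ℝ) : ℂ) * v x = (e : ℂ) * (((‖x‖ ^ (-b) : ℝ) : ℂ) * v x) :=
      fun b e v x ↦ by push_cast; ring
    have hL0 : ∀ b : ℝ, 0 < b → ∀ᵐ x : E d, gaussianConst b * ‖x‖ ^ (-b) ≠ 0 := fun b hb ↦ by
      filter_upwards [hne] with x hx
      have := norm_pos_iff.mpr hx
      have := gaussianConst_pos hb
      positivity
    have h1 := integral_mul_eq_integral_integral
      (k := fun t (x : E d) ↦ t ^ (a / 2 - 1) * Real.exp (-(Real.pi * t) * ‖x‖ ^ 2))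
      (L := fun x ↦ gaussianConst a * ‖x‖ ^ (-a)) (v := χ)
      (by simp only [Function.uncurry_def]; fun_prop)
      (fun t ht x ↦ by positivity)
      (by filter_upwards [hne] with x hx using integral_rpow_mul_gaussian ha0 hx) (hL0 a ha0)
      χ.continuous.aestronglyMeasurable
      (by simp only [hrw]; exact (integrable_norm_rpow_neg_mul hd had χ).const_mul _)
    have h2 := integral_mul_eq_integral_integral
      (k := fun t (x : E d) ↦ t ^ (-(α / 2) - 1) * Real.exp (-Real.pi * ‖x‖ ^ 2 / t))
      (L := fun x ↦ gaussianConst α * ‖x‖ ^ (-α)) (v := ψ)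
      (by simp only [Function.uncurry_def]; fun_prop)
      (fun t ht x ↦ by positivity)
      (by filter_upwards [hne] with x hx using integral_rpow_mul_gaussian_inv hα0 hx) (hL0 α hα0)
      ψ.continuous.aestronglyMeasurable
      (by simp only [hrw]; exact (integrable_norm_rpow_neg_mul hd hα ψ).const_mul _)
    have h3 : ∀ t ∈ Set.Ioi (0 : ℝ),
        ∫ x, ((t ^ (a / 2 - 1) * Real.exp (-(Real.pi * t) * ‖x‖ ^ 2) : ℝ) : ℂ) * (𝓕 ψ) x =
        ∫ x, ((t ^ (-(α / 2) - 1) * Real.exp (-Real.pi * ‖x‖ ^ 2 / t) : ℝ) : ℂ) * ψ x := by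
      intro t ht
      have ht0 : 0 < t := ht
      -- With a = d - α the powers match: a/2 - 1 - d/2 = -α/2 - 1.
      have e1 : t ^ (-(α / 2) - 1) = t ^ (a / 2 - 1) * t ^ (-((d : ℝ) / 2)) := by
        rw [← Real.rpow_add ht0, ha]; congr 1; ring
      calc _ = ((t ^ (a / 2 - 1) : ℝ) : ℂ) *
            ∫ x, ((Real.exp (-(Real.pi * t) * ‖x‖ ^ 2) : ℝ) : ℂ) * (𝓕 ψ) x := by
            rw [← integral_const_mul]
            congr 1; ext x; push_cast; ring
        _ = _ := by
            rw [integral_gaussian_mul_fourier ht0, ← integral_const_mul, e1]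
            congr 1; ext x; push_cast; ring
    have h4 := setIntegral_congr_fun (μ := volume) measurableSet_Ioi h3
    rw [← h1, ← h2] at h4
    simp only [hrw] at h4
    rw [integral_const_mul, integral_const_mul] at h4
    rw [TemperedDistribution.fourier_apply, hΛ]
    simp only [hrw]
    rw [integral_const_mul]
    have hcac : (gaussianConst a : ℂ) ≠ 0 := by exact_mod_cast hca.ne'
    rw [hc, Complex.ofReal_div, div_mul_eq_mul_div, ← h4, mul_div_cancel_left₀ _ hcac]
  · rw [Complex.norm_real, Real.norm_eq_abs, abs_of_nonneg (by positivity)]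

/-! ### Testing the Riesz potential on small balls -/

theorem Mollifier.scaled_nonneg (φ : Mollifier d) {ε : ℝ} (hε : 0 < ε) (x : E d) :
    0 ≤ φ.scaled ε x :=
  mul_nonneg (by positivity) (φ.nonneg _)

theorem Mollifier.integral_scaled_sub (φ : Mollifier d) {ε : ℝ} (hε : 0 < ε) (z : E d) :
    ∫ u, φ.scaled ε (z - u) = 1 := by
  have hεd : (0 : ℝ) < ε ^ d := by positivity
  rw [integral_sub_left_eq_self (fun u ↦ φ.scaled ε u) volume z]
  simp only [Mollifier.scaled]
  rw [integral_const_mul, Measure.integral_comp_smul, finrank_euclideanSpace_fin,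
    φ.integral_eq_one, inv_pow, inv_inv, abs_of_pos hεd, smul_eq_mul, mul_one,
    inv_mul_cancel₀ hεd.ne']

theorem Mollifier.integrable_scaled_sub (φ : Mollifier d) {ε : ℝ} (hε : 0 < ε) (z : E d) :
    Integrable fun u ↦ φ.scaled ε (z - u) := by
  by_contra h
  have := φ.integral_scaled_sub hε z
  rw [integral_undef h] at this
  exact zero_ne_one this

theorem Mollifier.exists_scaled_eq_zero (φ : Mollifier d) :
    ∃ R : ℝ, 0 < R ∧ ∀ ε : ℝ, 0 < ε → ∀ x : E d, ε * R < ‖x‖ → φ.scaled ε x = 0 := by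
  obtain ⟨R, hR, h⟩ := φ.compactSupport.isCompact.isBounded.exists_pos_norm_le
  refine ⟨R, hR, fun ε hε x hx ↦ ?_⟩
  rw [Mollifier.scaled]
  by_contra h0
  have hmem : ε⁻¹ • x ∈ tsupport φ.toFun := subset_tsupport _ (right_ne_zero_of_mul h0)
  have := h _ hmem
  rw [norm_smul, norm_inv, Real.norm_of_nonneg hε.le, inv_mul_le_iff₀ hε] at this
  linarith

theorem mollify_isRieszKernel {Λ : 𝓢'(E d, ℂ)} {α : ℝ} (hΛ : IsRieszKernel Λ α) (φ : Mollifier d)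
    {ε : ℝ} (hε : 0 < ε) (z : E d) : mollify Λ φ ε z =
      ((∫ u : E d, ‖u‖ ^ (-((d : ℝ) - α)) * φ.scaled ε (z - u) : ℝ) : ℂ) := by
  rw [mollify, dif_pos hε, hΛ, ← integral_complex_ofReal]
  refine integral_congr_ae (ae_of_all _ fun u ↦ ?_)
  beta_reduce
  rw [Complex.ofReal_mul]
  rfl

/-- The mollifier at z sees only points with |u| ≤ |z| + εR < 3r, where the radially decreasing
kernel is at least its value at radius 3r; the mollifier has total mass 1. -/
theorem le_integral_rieszKernel_mul_scaled (hd : 1 ≤ d) {α : ℝ} (hα0 : 0 < α) (hα : α < d)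
    (φ : Mollifier d) {R : ℝ} (hR : ∀ ε : ℝ, 0 < ε → ∀ x : E d, ε * R < ‖x‖ → φ.scaled ε x = 0)
    {ε r : ℝ} (hε : 0 < ε) (hεr : ε * R ≤ r) {z : E d} (hz : ‖z‖ < 2 * r) :
    (3 * r) ^ (-((d : ℝ) - α)) ≤ ∫ u : E d, ‖u‖ ^ (-((d : ℝ) - α)) * φ.scaled ε (z - u) := by
  have hnt : Nontrivial (E d) := Module.nontrivial_of_finrank_pos (R := ℝ)
    (by rw [finrank_euclideanSpace_fin]; omega)
  have hne : ∀ᵐ x : E d, x ≠ 0 := by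
    rw [ae_iff]; simp
  have hint : Integrable fun u : E d ↦ ‖u‖ ^ (-((d : ℝ) - α)) * φ.scaled ε (z - u) := by
    have h := (integrable_norm_rpow_neg_mul hd (a := (d : ℝ) - α) (by linarith)
      (φ.shiftedSchwartz hε z)).re
    refine h.congr (ae_of_all _ fun u ↦ ?_)
    have e : (φ.shiftedSchwartz hε z) u = ((φ.scaled ε (z - u) : ℝ) : ℂ) := rfl
    beta_reduce
    rw [e, ← Complex.ofReal_mul]
    rfl
  calc (3 * r) ^ (-((d : ℝ) - α)) = ∫ u, (3 * r) ^ (-((d : ℝ) - α)) * φ.scaled ε (z - u) := by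
        rw [integral_const_mul, φ.integral_scaled_sub hε, mul_one]
    _ ≤ _ := by
        refine integral_mono_ae ((φ.integrable_scaled_sub hε z).const_mul _) hint ?_
        filter_upwards [hne] with u hu
        rcases le_or_gt ‖u‖ (3 * r) with h | h
        · refine mul_le_mul_of_nonneg_right ?_ (φ.scaled_nonneg hε _)
          exact Real.rpow_le_rpow_of_nonpos (norm_pos_iff.mpr hu) h (by linarith)
        · rw [hR ε hε (z - u), mul_zero, mul_zero]
          have : ‖u‖ ≤ ‖z‖ + ‖z - u‖ := by
            calc ‖u‖ = ‖z - (z - u)‖ := by rw [sub_sub_cancel]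
              _ ≤ _ := norm_sub_le _ _
          linarith

/-- The lower bound for the regularised Riesz potential of a ball, on the same ball. -/
theorem le_norm_regConv_indicator_ball (hd : 1 ≤ d) {α : ℝ} (hα0 : 0 < α) (hα : α < d)
    {Λ : 𝓢'(E d, ℂ)} (hΛ : IsRieszKernel Λ α) (φ : Mollifier d) {R : ℝ}
    (hR : ∀ ε : ℝ, 0 < ε → ∀ x : E d, ε * R < ‖x‖ → φ.scaled ε x = 0)
    {μ : Measure (E d)} [IsFiniteMeasure μ] {ε r : ℝ} (hε : 0 < ε) (hεr : ε * R ≤ r)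
    {x : E d} (hx : x ∈ Metric.ball (0 : E d) r) :
    (3 * r) ^ (-((d : ℝ) - α)) * μ.real (Metric.ball 0 r) ≤
      ‖regConv Λ φ μ ε ((Metric.ball (0 : E d) r).indicator fun _ ↦ 1) x‖ := by
  obtain ⟨m, hm, hΛm, C, hC⟩ := fourierDecay_of_isRieszKernel hd hα0 hα hΛ
  have hmi := integrable_mul_hat hm hC φ hε
  have hmol : ∀ z, mollify Λ φ ε z =
      fourierOf volume (fun ξ ↦ m ξ * φ.hat (ε • ξ)) (-z) := by
    intro z
    rw [mollify_eq_integral hΛm φ hε]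
    simp only [fourierOf, VectorFourier.fourierIntegral, innerₗ_apply_apply, inner_neg_right,
      neg_neg, real_inner_comm z]
  set k : E d → ℝ := fun z ↦ ∫ u : E d, ‖u‖ ^ (-((d : ℝ) - α)) * φ.scaled ε (z - u) with hk
  have hkmol : ∀ z, mollify Λ φ ε z = (k z : ℂ) := mollify_isRieszKernel hΛ φ hε
  have hkint : Integrable (fun y ↦ k (x - y)) μ := by
    -- The Fourier representation gives continuity and boundedness of the mollified kernel, hence
    -- its integrability against μ.
    have hkre : ∀ z, k z = (fourierOf volume (fun ξ ↦ m ξ * φ.hat (ε • ξ)) (-z)).re := fun z ↦ by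
      rw [← hmol, hkmol, Complex.ofReal_re]
    have hcont : Continuous k := by
      have := continuous_fourierOf hmi
      simp only [funext hkre]
      fun_prop
    refine Integrable.of_bound (by fun_prop : Continuous fun y ↦ k (x - y)).aestronglyMeasurable
      (∫ ξ, ‖m ξ * φ.hat (ε • ξ)‖) (ae_of_all _ fun y ↦ ?_)
    rw [hkre]
    exact (Complex.abs_re_le_norm _).trans (norm_fourierOf_le _ _ _)
  have hreg : regConv Λ φ μ ε ((Metric.ball (0 : E d) r).indicator fun _ ↦ 1) x =
      ((∫ y in Metric.ball (0 : E d) r, k (x - y) ∂μ : ℝ) : ℂ) := by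
    rw [regConv, ← integral_complex_ofReal, ← integral_indicator Metric.isOpen_ball.measurableSet]
    refine integral_congr_ae (ae_of_all _ fun y ↦ ?_)
    by_cases hy : y ∈ Metric.ball (0 : E d) r <;> simp [hy, hkmol, -Metric.mem_ball]
  rw [hreg, Complex.norm_real]
  refine le_trans ?_ (le_abs_self _)
  calc _ = ∫ _ in Metric.ball (0 : E d) r, (3 * r) ^ (-((d : ℝ) - α)) ∂μ := by
        rw [setIntegral_const, smul_eq_mul, mul_comm]
    _ ≤ _ := by
        refine setIntegral_mono_on (integrable_const _) hkint.integrableOn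
          Metric.isOpen_ball.measurableSet fun y hy ↦ ?_
        refine le_integral_rieszKernel_mul_scaled hd hα0 hα φ hR hε hεr ?_
        rw [mem_ball_zero_iff] at hx hy
        calc ‖x - y‖ ≤ ‖x‖ + ‖y‖ := norm_sub_le _ _
          _ < 2 * r := by linarith

/-- Testing boundedness of the Riesz potential on the indicator of a ball. -/
theorem le_of_convBounded_rieszKernel (hd : 1 ≤ d) {α : ℝ} (hα0 : 0 < α) (hα : α < d)
    {Λ : 𝓢'(E d, ℂ)} (hΛ : IsRieszKernel Λ α) (φ : Mollifier d) {μ : Measure (E d)}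
    [IsFiniteMeasure μ] {p q : ℝ≥0∞} (hp : 1 ≤ p) (hq : 1 ≤ q) (hb : ConvBounded Λ φ μ p q) :
    ∃ K : ℝ≥0, ∀ r : ℝ, 0 < r → μ (Metric.ball 0 r) ≠ 0 →
      ENNReal.ofReal ((3 * r) ^ (-((d : ℝ) - α)) * μ.real (Metric.ball 0 r)) *
        μ (Metric.ball 0 r) ^ (1 / q.toReal) ≤ K * μ (Metric.ball 0 r) ^ (1 / p.toReal) := by
  obtain ⟨K, hK⟩ := hb
  refine ⟨K, fun r hr hμ0 ↦ ?_⟩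
  obtain ⟨R, hR0, hR⟩ := φ.exists_scaled_eq_zero
  set B := Metric.ball (0 : E d) r with hB
  have hBm : MeasurableSet B := Metric.isOpen_ball.measurableSet
  set f : E d → ℂ := B.indicator fun _ ↦ 1 with hf
  have hfL : ∀ p', MemLp f p' μ := fun p' ↦ memLp_indicator_const p' hBm 1 (Or.inr (by simp))
  have hp0 : p ≠ 0 := (zero_lt_one.trans_le hp).ne'
  have hq0 : q ≠ 0 := (zero_lt_one.trans_le hq).ne'
  have hfp : eLpNorm f p μ = μ B ^ (1 / p.toReal) := by
    rw [hf, eLpNorm_indicator_const' hBm hμ0 hp0]; simp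
  obtain ⟨h, ⟨hhL, hlim⟩, hbound⟩ := hK f (hfL p)
  rw [hfp] at hbound
  obtain ⟨m, hm, hΛm, C, hC⟩ := fourierDecay_of_isRieszKernel hd hα0 hα hΛ
  set c : ℝ := (3 * r) ^ (-((d : ℝ) - α)) * μ.real B with hc
  have hlim' : Tendsto (fun ε ↦ eLpNorm (fun x ↦ regConv Λ φ μ ε f x - h x) q μ +
      K * μ B ^ (1 / p.toReal)) (𝓝[>] 0) (𝓝 (0 + K * μ B ^ (1 / p.toReal))) :=
    hlim.add tendsto_const_nhds
  rw [zero_add] at hlim'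
  refine ge_of_tendsto hlim' ?_
  -- For ε < r/R the lower bound on the ball does not depend on ε, so it passes to the limit h.
  filter_upwards [Ioo_mem_nhdsGT (div_pos hr hR0)] with ε hε
  have hεr : ε * R ≤ r := by
    have := hε.2
    rw [lt_div_iff₀ hR0] at this
    exact this.le
  have hreg : MemLp (regConv Λ φ μ ε f) q μ := by
    have hfun : regConv Λ φ μ ε f = multiplierConv (fun ξ ↦ m ξ * φ.hat (ε • ξ)) μ f :=
      funext fun x ↦ regConv_eq_multiplierConv hΛm φ hε.1 (integrable_mul_hat hm hC φ hε.1)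
        ((hfL 1).integrable le_rfl) x
    rw [hfun]
    exact memLp_multiplierConv (integrable_mul_hat hm hC φ hε.1) ((hfL 1).integrable le_rfl) q
  -- For q = ∞ the exponent 1 / `q.toReal` is 0, so the same formula gives the sup norm of the
  -- indicator; this is where nonzero mass of the ball matters.
  calc ENNReal.ofReal c * μ B ^ (1 / q.toReal) = eLpNorm (B.indicator fun _ ↦ c) q μ := by
        rw [eLpNorm_indicator_const' hBm hμ0 hq0, Real.enorm_eq_ofReal (by positivity)]
    _ ≤ eLpNorm (regConv Λ φ μ ε f) q μ := by
        refine eLpNorm_mono fun x ↦ ?_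
        by_cases hx : x ∈ B
        · rw [Set.indicator_of_mem hx, Real.norm_of_nonneg (by positivity)]
          exact le_norm_regConv_indicator_ball hd hα0 hα hΛ φ hR hε.1 hεr hx
        · rw [Set.indicator_of_notMem hx, norm_zero]
          exact norm_nonneg _
    _ = eLpNorm ((regConv Λ φ μ ε f - h) + h) q μ := by rw [sub_add_cancel]
    _ ≤ eLpNorm (regConv Λ φ μ ε f - h) q μ + eLpNorm h q μ :=
        eLpNorm_add_le (hreg.sub hhL).aestronglyMeasurable hhL.aestronglyMeasurable hq
    _ ≤ _ := by gcongr; rfl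

theorem not_convBounded_rieszKernel (hd : 1 ≤ d) {α s κ : ℝ} (hα0 : 0 < α) (hα : α < d)
    (hκ : 0 < κ) {Λ : 𝓢'(E d, ℂ)} (hΛ : IsRieszKernel Λ α) (φ : Mollifier d)
    {μ : Measure (E d)} [IsFiniteMeasure μ]
    (hμ : ∀ r : ℝ, 0 < r → r ≤ 1 → μ (Metric.ball 0 r) = ENNReal.ofReal (κ * r ^ s))
    {p q : ℝ≥0∞} (hp : 1 ≤ p) (hq : 1 ≤ q)
    (hpq : s + s * (1 / q.toReal) - ((d : ℝ) - α) < s * (1 / p.toReal)) :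
    ¬ ConvBounded Λ φ μ p q := by
  intro hb
  obtain ⟨K, hK⟩ := le_of_convBounded_rieszKernel hd hα0 hα hΛ φ hp hq hb
  set P : ℝ := 1 / p.toReal with hP
  set Q : ℝ := 1 / q.toReal with hQ
  have hP0 : 0 ≤ P := by positivity
  have hQ0 : 0 ≤ Q := by positivity
  set a : ℝ := (d : ℝ) - α with ha
  -- After division by r^(s + sQ - a), the tested inequality bounds a positive constant by a
  -- multiple of r^e, which is impossible as r → 0 since e > 0.
  set e : ℝ := s * P - (s + s * Q - a) with he
  have he0 : 0 < e := by rw [he]; linarith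
  have key : ∀ r : ℝ, 0 < r → r ≤ 1 → 3 ^ (-a) * κ * κ ^ Q ≤ K * κ ^ P * r ^ e := by
    intro r hr hr1
    have hM : 0 < κ * r ^ s := by positivity
    have h := hK r hr (by rw [hμ r hr hr1]; simpa using hM)
    rw [measureReal_def, hμ r hr hr1, ENNReal.toReal_ofReal hM.le,
      ENNReal.ofReal_rpow_of_nonneg hM.le hQ0, ENNReal.ofReal_rpow_of_nonneg hM.le hP0,
      ← ENNReal.ofReal_mul (by positivity), ← ENNReal.ofReal_coe_nnreal,
      ← ENNReal.ofReal_mul (by positivity), ENNReal.ofReal_le_ofReal_iff (by positivity),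
      Real.mul_rpow (by norm_num) hr.le, Real.mul_rpow hκ.le (by positivity),
      Real.mul_rpow hκ.le (by positivity), ← Real.rpow_mul hr.le, ← Real.rpow_mul hr.le] at h
    have hX : 0 < r ^ (s + s * Q - a) := by positivity
    have e1 : r ^ (s + s * Q - a) = r ^ (-a) * r ^ s * r ^ (s * Q) := by
      rw [← Real.rpow_add hr, ← Real.rpow_add hr]; congr 1; ring
    have e2 : r ^ (s * P) = r ^ e * r ^ (s + s * Q - a) := by
      rw [← Real.rpow_add hr]; congr 1; rw [he]; ring
    refine le_of_mul_le_mul_right ?_ hX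
    calc _ = 3 ^ (-a) * r ^ (-a) * (κ * r ^ s) * (κ ^ Q * r ^ (s * Q)) := by rw [e1]; ring
      _ ≤ _ := h
      _ = _ := by rw [e2]; ring
  have hlim : Tendsto (fun r : ℝ ↦ (K : ℝ) * κ ^ P * r ^ e) (𝓝[>] 0) (𝓝 0) := by
    have h1 : Tendsto (fun r : ℝ ↦ r ^ e) (𝓝[>] 0) (𝓝 0) := by
      have := ((Real.continuous_rpow_const he0.le).tendsto 0).mono_left
        (nhdsWithin_le_nhds (s := Set.Ioi 0))
      rwa [Real.zero_rpow he0.ne'] at this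
    simpa using h1.const_mul ((K : ℝ) * κ ^ P)
  have hle : 3 ^ (-a) * κ * κ ^ Q ≤ 0 := by
    refine ge_of_tendsto hlim ?_
    filter_upwards [Ioo_mem_nhdsGT zero_lt_one] with r hr using key r hr.1 hr.2.le
  have : 0 < 3 ^ (-a) * κ * κ ^ Q := by positivity
  linarith

/-! ### The extremal measure |x|^(s-d) dx -/

theorem exists_powerMeasure_ball_zero (hd : 1 ≤ d) {s : ℝ} (hs : 0 < s) :
    ∃ κ : ℝ, 0 < κ ∧ ∀ r : ℝ, 0 < r →
      powerMeasure d (d - s) (Metric.ball 0 r) = ENNReal.ofReal (κ * r ^ s) := by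
  have hnt : Nontrivial (E d) := Module.nontrivial_of_finrank_pos (R := ℝ)
    (by rw [finrank_euclideanSpace_fin]; omega)
  have hv : 0 < volume.real (Metric.ball (0 : E d) 1) :=
    ENNReal.toReal_pos (Metric.measure_ball_pos _ _ one_pos).ne' measure_ball_lt_top.ne
  have hd0 : (0 : ℝ) < d := by exact_mod_cast hd
  refine ⟨d * volume.real (Metric.ball (0 : E d) 1) / s, by positivity, fun r hr ↦ ?_⟩
  have hint : IntegrableOn (fun x : E d ↦ ‖x‖ ^ (-((d : ℝ) - s))) (Metric.ball 0 r) :=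
    ((locallyIntegrable_norm_rpow_neg hd (a := (d : ℝ) - s) (by linarith)).integrableOn_isCompact
      (isCompact_closedBall 0 r)).mono_set Metric.ball_subset_closedBall
  rw [powerMeasure, withDensity_apply _ Metric.isOpen_ball.measurableSet,
    ← ofReal_integral_eq_lintegral_ofReal hint (ae_of_all _ fun x ↦ by positivity)]
  congr 1
  have h := integral_fun_norm_addHaar (volume : Measure (E d))
    ((Set.Iio r).indicator fun y : ℝ ↦ y ^ (-((d : ℝ) - s)))
  have hl : ∫ x in Metric.ball (0 : E d) r, ‖x‖ ^ (-((d : ℝ) - s)) =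
      ∫ x : E d, (Set.Iio r).indicator (fun y : ℝ ↦ y ^ (-((d : ℝ) - s))) ‖x‖ := by
    rw [← integral_indicator Metric.isOpen_ball.measurableSet]
    congr 1; ext x
    simp [Set.indicator]
  have hr' : ∫ y in Set.Ioi (0 : ℝ), y ^ (d - 1) •
      (Set.Iio r).indicator (fun y : ℝ ↦ y ^ (-((d : ℝ) - s))) y = r ^ s / s := by
    calc _ = ∫ y in Set.Ioi (0 : ℝ), (Set.Iio r).indicator (fun y : ℝ ↦ y ^ (s - 1)) y := by
          refine setIntegral_congr_fun measurableSet_Ioi fun y hy ↦ ?_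
          have hy0 : 0 < y := hy
          by_cases hyr : y < r
          · simp only [Set.indicator, Set.mem_Iio, hyr, if_true, smul_eq_mul]
            rw [← Real.rpow_natCast, ← Real.rpow_add hy0, Nat.cast_sub hd]
            congr 1; push_cast; ring
          · simp [Set.indicator, hyr]
      _ = ∫ y in (0 : ℝ)..r, y ^ (s - 1) := by
          rw [setIntegral_indicator measurableSet_Iio, intervalIntegral.integral_of_le hr.le,
            Set.Ioi_inter_Iio, integral_Ioc_eq_integral_Ioo]
      _ = _ := by
          rw [integral_rpow (Or.inl (by linarith)), sub_add_cancel, Real.zero_rpow hs.ne', sub_zero]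
  rw [hl, h, finrank_euclideanSpace_fin, hr', smul_eq_mul, nsmul_eq_mul]
  ring

/-- If |x| < 2r the ball lies in B(0,3r), whose mass is known exactly. Otherwise every point of the
ball has norm at least r, so the density is at most r^(s-d) because s ≤ d, and the volume
contributes r^d. -/
theorem ballCondition_powerMeasure_restrict (hd : 1 ≤ d) {s : ℝ} (hs : 0 < s) (hsd : s ≤ d) :
    BallCondition ((powerMeasure d (d - s)).restrict (Metric.ball 0 1)) s := by
  obtain ⟨κ, hκ, hball⟩ := exists_powerMeasure_ball_zero hd hs
  set V : ℝ := volume.real (Metric.ball (0 : E d) 1) with hV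
  have hnt : Nontrivial (E d) := Module.nontrivial_of_finrank_pos (R := ℝ)
    (by rw [finrank_euclideanSpace_fin]; omega)
  refine ⟨κ * 3 ^ s + V, 1, one_pos, fun x r hr _ ↦ ?_⟩
  refine (Measure.restrict_apply_le _ _).trans ?_
  have hV0 : 0 ≤ V := measureReal_nonneg
  rcases lt_or_ge ‖x‖ (2 * r) with hx | hx
  · calc _ ≤ powerMeasure d (d - s) (Metric.ball 0 (3 * r)) :=
          measure_mono (Metric.ball_subset_ball' (by rw [dist_zero_right]; linarith))
      _ = ENNReal.ofReal (κ * (3 * r) ^ s) := hball _ (by positivity)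
      _ ≤ _ := by
        refine ENNReal.ofReal_le_ofReal ?_
        rw [Real.mul_rpow (by norm_num) hr.le, ← mul_assoc]
        gcongr
        linarith
  · have hdens : ∀ y ∈ Metric.ball x r, ENNReal.ofReal (‖y‖ ^ (-((d : ℝ) - s))) ≤
        ENNReal.ofReal (r ^ (-((d : ℝ) - s))) := by
      intro y hy
      refine ENNReal.ofReal_le_ofReal (Real.rpow_le_rpow_of_nonpos hr ?_ (by linarith))
      rw [Metric.mem_ball, dist_eq_norm] at hy
      have : ‖x‖ ≤ ‖y‖ + ‖y - x‖ := by
        calc ‖x‖ = ‖y - (y - x)‖ := by rw [sub_sub_cancel]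
          _ ≤ _ := norm_sub_le _ _
      linarith
    rw [powerMeasure, withDensity_apply _ Metric.isOpen_ball.measurableSet]
    calc _ ≤ ∫⁻ _ in Metric.ball x r, ENNReal.ofReal (r ^ (-((d : ℝ) - s))) :=
          setLIntegral_mono' Metric.isOpen_ball.measurableSet hdens
      _ = ENNReal.ofReal (V * r ^ s) := by
          rw [setLIntegral_const, Measure.addHaar_ball _ _ hr.le, finrank_euclideanSpace_fin,
            ← ENNReal.ofReal_toReal (measure_ball_lt_top (μ := volume) (x := (0 : E d))).ne,
            ← measureReal_def, ← hV, ← ENNReal.ofReal_mul (by positivity),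
            ← ENNReal.ofReal_mul (by positivity)]
          congr 1
          have : r ^ s = r ^ (-((d : ℝ) - s)) * r ^ d := by
            rw [← Real.rpow_natCast, ← Real.rpow_add hr]; congr 1; ring
          rw [this]; ring
      _ ≤ _ := by
          refine ENNReal.ofReal_le_ofReal ?_
          gcongr
          linarith [(by positivity : 0 ≤ κ * 3 ^ s)]

theorem compactlySupported_restrict_ball (μ : Measure (E d)) (r : ℝ) :
    CompactlySupported (μ.restrict (Metric.ball 0 r)) := by
  refine ⟨Metric.closedBall 0 r, isCompact_closedBall 0 r, ?_⟩
  have hdisj : (Metric.closedBall (0 : E d) r)ᶜ ∩ Metric.ball 0 r = ∅ :=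
    (disjoint_compl_left.mono_right Metric.ball_subset_closedBall).inter_eq
  rw [Measure.restrict_apply Metric.isClosed_closedBall.measurableSet.compl, hdisj, measure_empty]

theorem toReal_inv_conjExponent_ofReal {p : ℝ} (hp : 1 ≤ p) :
    1 / (ENNReal.conjExponent (ENNReal.ofReal p)).toReal = 1 - 1 / p := by
  have h : (ENNReal.ofReal p).HolderConjugate (ENNReal.conjExponent (ENNReal.ofReal p)) :=
    ENNReal.HolderConjugate.conjExponent (by rwa [ENNReal.one_le_ofReal])
  have h1 := congrArg ENNReal.toReal (ENNReal.HolderConjugate.inv_add_inv_eq_one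
    (ENNReal.ofReal p) (ENNReal.conjExponent (ENNReal.ofReal p)))
  have hp0 : (ENNReal.ofReal p)⁻¹ ≠ ⊤ := ENNReal.inv_ne_top.mpr h.ne_zero
  have hq0 : (ENNReal.conjExponent (ENNReal.ofReal p))⁻¹ ≠ ⊤ :=
    ENNReal.inv_ne_top.mpr h.symm.ne_zero
  rw [ENNReal.toReal_add hp0 hq0, ENNReal.toReal_inv, ENNReal.toReal_inv,
    ENNReal.toReal_ofReal (by linarith), ENNReal.toReal_one] at h1
  rw [one_div, one_div]
  linarith

end FractalConv

end

/-! ### Assembly of the theorem -/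

open FractalConv in
theorem theorem2 (d : ℕ) (hd : 2 ≤ d) :
    (∀ (α s : ℝ) (Λ : 𝓢'(E d, ℂ)) (μ : Measure (E d)) (φ : Mollifier d),
      FourierDecay Λ α → CompactlySupported μ → BallCondition μ s → 0 < s → (d : ℝ) - α < s →
      ∀ p : ℝ, 1 ≤ p → 1 / 2 ≤ 1 / p →
        (1 / p < (3 * s + 2 * α - 2 * d) / (2 * s) →
          ConvBounded Λ φ μ (ENNReal.ofReal p) 2) ∧
        (1 / p < (2 * s + α - d) / (2 * s) →
          ConvBounded Λ φ μ (ENNReal.ofReal p) (ENNReal.conjExponent (ENNReal.ofReal p)))) ∧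
    (∀ α : ℝ, 0 < α → α < d →
      ∃ Λ : 𝓢'(E d, ℂ), IsRieszKernel Λ α ∧ FourierDecay Λ α ∧
        ∀ s : ℝ, 0 < s → s ≤ d →
          ∃ μ : Measure (E d), CompactlySupported μ ∧ BallCondition μ s ∧
            ∀ φ : Mollifier d,
              (∀ p : ℝ, 1 ≤ p → (3 * s + 2 * α - 2 * d) / (2 * s) < 1 / p →
                ¬ ConvBounded Λ φ μ (ENNReal.ofReal p) 2) ∧
              (∀ p : ℝ, 1 ≤ p → (2 * s + α - d) / (2 * s) < 1 / p →
                ¬ ConvBounded Λ φ μ (ENNReal.ofReal p)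
                    (ENNReal.conjExponent (ENNReal.ofReal p))) ∧
              (s < (d : ℝ) - α → ∀ p q : ℝ≥0∞, 1 ≤ p → p ≤ q → ¬ ConvBounded Λ φ μ p q)) := by
  refine ⟨fun α s Λ μ φ hΛ hK hB hs _ p hp1 hp2 ↦ ?_, fun α hα0 hα ↦ ?_⟩
  · have hp2' : p ≤ 2 := (one_div_le_one_div two_pos (by linarith)).mp hp2
    exact ⟨convBounded_lp_two hΛ hK hB hs φ hp1 hp2',
      convBounded_lp_conjExponent hΛ hK hB hs φ hp1 hp2'⟩
  · have hd1 : 1 ≤ d := by omega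
    obtain ⟨Λ, hΛ⟩ := exists_isRieszKernel hd1 hα0 hα
    refine ⟨Λ, hΛ, fourierDecay_of_isRieszKernel hd1 hα0 hα hΛ, fun s hs hsd ↦ ?_⟩
    obtain ⟨κ, hκ, hball⟩ := exists_powerMeasure_ball_zero hd1 hs
    set μ : Measure (E d) := (powerMeasure d (d - s)).restrict (Metric.ball 0 1) with hμ
    have hμK : CompactlySupported μ := compactlySupported_restrict_ball _ _
    have hμB : BallCondition μ s := ballCondition_powerMeasure_restrict hd1 hs hsd
    have hfin : IsFiniteMeasure μ := (exists_ball_bound hμK hμB hs).1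
    have hμball : ∀ r : ℝ, 0 < r → r ≤ 1 →
        μ (Metric.ball 0 r) = ENNReal.ofReal (κ * r ^ s) := fun r hr hr1 ↦ by
      rw [hμ, Measure.restrict_apply Metric.isOpen_ball.measurableSet,
        Set.inter_eq_self_of_subset_left (Metric.ball_subset_ball hr1), hball r hr]
    refine ⟨μ, hμK, hμB, fun φ ↦ ⟨fun p hp1 hp ↦ ?_, fun p hp1 hp ↦ ?_, fun hsα p q hp hpq ↦ ?_⟩⟩
    · refine not_convBounded_rieszKernel hd1 hα0 hα hκ hΛ φ hμball
        (by rwa [ENNReal.one_le_ofReal]) one_le_two ?_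
      rw [ENNReal.toReal_ofReal (by linarith), ENNReal.toReal_ofNat]
      rw [div_lt_iff₀ (by positivity)] at hp
      linarith
    · have hh : (ENNReal.ofReal p).HolderConjugate (ENNReal.conjExponent (ENNReal.ofReal p)) :=
        ENNReal.HolderConjugate.conjExponent (by rwa [ENNReal.one_le_ofReal])
      refine not_convBounded_rieszKernel hd1 hα0 hα hκ hΛ φ hμball
        (by rwa [ENNReal.one_le_ofReal]) hh.symm.one_le ?_
      rw [ENNReal.toReal_ofReal (by linarith), toReal_inv_conjExponent_ofReal hp1]
      rw [div_lt_iff₀ (by positivity)] at hp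
      linarith
    · refine not_convBounded_rieszKernel hd1 hα0 hα hκ hΛ φ hμball hp (hp.trans hpq) ?_
      -- The case q = ∞ is separate because `toReal` sends ∞ to 0; the convention 1/0 = 0 then gives
      -- the correct reciprocal. With p ≤ q and s < d - α, both contributions to the exponent
      -- inequality have the right sign.
      have hinv : 1 / q.toReal ≤ 1 / p.toReal := by
        rcases eq_or_ne q ⊤ with rfl | hq
        · simp
        · have hp0 : 0 < p.toReal := ENNReal.toReal_pos (zero_lt_one.trans_le hp).ne'
            (ne_top_of_le_ne_top hq hpq)
          exact one_div_le_one_div_of_le hp0 (ENNReal.toReal_mono hq hpq)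
      have := mul_le_mul_of_nonneg_left hinv hs.le
      linarith
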